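/- **Definitions.** Graphs are simple, undirected, with vertex set $[n]$. $N(v)$ is the neighbourhood of a vertex $v$, and $N(S)$ is the set of vertices outside $S$ with a neighbour in $S$. *$d$-light.* An adaptive vertex exposure process on a graph first exposes an arbitrary vertex and then repeatedly exposes a vertex of $N(S)$, where $S$ is the set exposed so far, or stops; upon exposure of $v$ it learns $N(v)$, and its choices depend only on what it has learned. A distribution $G=([n],E)$ on graphs is *$d$-light* ($d>0$) if for every adaptively exposed $S$, conditioned on any instantiation of $S\cup N(S)$ and of $\{(u,w)\in E: u\in S\}$, for every $v\in N(S)\setminus S$ (any $v$ if $S=\emptyset$) there is an integer $\alpha$, $d\le\alpha\le n$, such that $|N(v)\setminus S|$ is stochastically dominated by the binomial distribution $B(\alpha,d/\alpha)$, i.e. $\Pr[|N(v)\setminus S|>x]\le\Pr[B(\alpha,d/\alpha)>x]$ for all real $x$. *Hash functions.* A finite family $\mathcal H$ of functions $[n]\to[L]$ is *$\varepsilon$-almost adaptive $k$-wise independent* if for every (computationally unbounded) adaptive distinguisher $D$ making at most $k$ oracle queries, $|\Pr[D^{h}=1]-\Pr[D^{F}=1]|\le\varepsilon$, where $h$ is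 uniform in $\mathcal H$ and $F$ is a uniformly random function $[n]\to[L]$. *Relevant vicinity.* For $h:[n]\to[L]$, order the vertices by their ranks $(h(i),i)$, compared lexicographically. The *relevant vicinity* of $v$ is the smallest set containing $v$ and, with each of its vertices $u$, all neighbours of $u$ that precede $u$ in this order. Let $E_L=E_L(v)$ be the set of edges with at least one endpoint in the relevant vicinity of $v$. **Statement.** There is a universal constant $c>0$ such that for every $d>0$ and every $A$ there is a constant $C=C(d,A)$ with the following property. Let $L$ be an integer with $24d<L\le A\,d$ (so $L=O(d)$), let $n$ be a positive integer, put $\kappa=2^L c\log n$, and let $k\ge 6d\kappa$ be an integer. Let $G$ be a $d$-light distribution on graphs with vertex set $[n]$, and let $h$ be sampled, independently of $G$, uniformly from a $\frac1{2n^5}$-almost adaptive $k$-wise independent family of functions $[n]\to[L]$. Then for every vertex $v$, $$\mathbb E\big[|E_L(v)|^2\big]\le C,$$ the expectation being over both $G$ and $h$. -/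

import Mathlib

open MeasureTheory

/-! ### Almost adaptive `k`-wise independent hash families -/

/-- Probability of the event `A` under a uniformly random element of the finite type `α`. -/
noncomputable def uniformProb {α : Type*} [Fintype α] (A : Set α) : ℝ :=
  (A.ncard : ℝ) / Fintype.card α

/-- Expectation of `f` at a uniformly random element of the finite type `α`. -/
noncomputable def uniformExpect {α : Type*} [Fintype α] (f : α → ℝ) : ℝ :=
  (∑ a, f a) / Fintype.card α

/-- A (computationally unbounded) adaptive distinguisher with oracle access to a function `X → Y`:
either it outputs a bit, or it queries the oracle at a point and continues in a way that depends
on the answer. -/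
inductive Distinguisher (X Y : Type) : Type
  | output (b : Bool) : Distinguisher X Y
  | query (x : X) (cont : Y → Distinguisher X Y) : Distinguisher X Y

/-- The bit that the distinguisher outputs when its oracle is `F`. -/
def Distinguisher.eval {X Y : Type} (F : X → Y) : Distinguisher X Y → Bool
  | .output b => b
  | .query x cont => (cont (F x)).eval F

/-- The number of oracle queries that the distinguisher makes when its oracle is `F`. -/
def Distinguisher.numQueries {X Y : Type} (F : X → Y) : Distinguisher X Y → ℕ
  | .output _ => 0
  | .query x cont => (cont (F x)).numQueries F + 1

/-- The family `H` of functions `[n] → [L]`, indexed by a finite set of seeds, is `ε`-almost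
adaptive `k`-wise independent: no distinguisher making at most `k` queries tells a uniformly
sampled member of the family from a uniformly random function with advantage more than `ε`. -/
def AlmostAdaptiveIndep {n L : ℕ} {ι : Type*} [Fintype ι] (ε : ℝ) (k : ℕ)
    (H : ι → Fin n → Fin L) : Prop :=
  ∀ D : Distinguisher (Fin n) (Fin L), (∀ F : Fin n → Fin L, D.numQueries F ≤ k) →
    |uniformProb {i : ι | D.eval (H i) = true}
      - uniformProb {F : Fin n → Fin L | D.eval F = true}| ≤ ε

/-! ### Adaptive exposure and `d`-light distributions on graphs -/

/-- `N(S)`: the vertices outside `S` with a neighbour in `S`. -/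
def outerNeighbors {V : Type*} (G : SimpleGraph V) (S : Set V) : Set V :=
  {u | u ∉ S ∧ ∃ w ∈ S, G.Adj w u}

/-- The set of edges of `G` with at least one endpoint in `S`. -/
def incidentEdges {V : Type*} (G : SimpleGraph V) (S : Set V) : Set (Sym2 V) :=
  {e | e ∈ G.edgeSet ∧ ∃ u ∈ S, u ∈ e}

/-- An adaptive vertex exposure process. Given the list of vertices exposed so far, each with the
neighbourhood revealed for it, it names the next vertex to expose, or stops. -/
def ExposureProcess (V : Type*) : Type _ := List (V × Set V) → Option V

open Classical in
/-- The first `t` rounds of the process `P` on the graph `G`. The first exposed vertex is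
arbitrary; afterwards a vertex is exposed only if it lies in `N(S)`, where `S` is the set of
vertices exposed so far (a move to any other vertex is void). -/
noncomputable def ExposureProcess.run {V : Type*} (P : ExposureProcess V) (G : SimpleGraph V) :
    ℕ → List (V × Set V)
  | 0 => []
  | t + 1 =>
    let hist := P.run G t
    match P hist with
    | none => hist
    | some v =>
      if hist = [] ∨ ((∀ e ∈ hist, e.1 ≠ v) ∧ ∃ e ∈ hist, v ∈ e.2) then
        hist ++ [(v, G.neighborSet v)]
      else hist

/-- The set of vertices that the process `P` has exposed on `G` after `t` rounds. -/
def ExposureProcess.exposed {V : Type*} (P : ExposureProcess V) (G : SimpleGraph V) (t : ℕ) :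
    Set V :=
  {v | ∃ e ∈ P.run G t, e.1 = v}

/-- First-order stochastic dominance for distributions on the natural numbers. -/
def StochDominated (X Y : Measure ℕ) : Prop :=
  ∀ x : ℝ, X {m : ℕ | x < (m : ℝ)} ≤ Y {m : ℕ | x < (m : ℝ)}

/-- The event that the set exposed by `P` after `t` rounds is `S`, that `S ∪ N(S)` is `T`, and that
the set of edges with an endpoint in `S` is `E`. -/
def exposureEvent {V : Type*} (P : ExposureProcess V) (t : ℕ) (S T : Set V) (E : Set (Sym2 V)) :
    Set (SimpleGraph V) :=
  {G | P.exposed G t = S ∧ S ∪ outerNeighbors G S = T ∧ incidentEdges G S = E}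

/-- The distribution `μ` on graphs with vertex set `[n]` is `d`-light: for every adaptively exposed
set `S`, conditioned on any instantiation (of positive probability) of `S ∪ N(S)` and of the edges
at `S`, for every `v ∈ N(S) \ S` (any `v` if `S = ∅`) there is `d ≤ α ≤ n` such that
`|N(v) \ S|` is stochastically dominated by the binomial distribution `B(α, d / α)`. -/
def IsLight {n : ℕ} (d : ℝ) (μ : PMF (SimpleGraph (Fin n))) : Prop :=
  ∀ (P : ExposureProcess (Fin n)) (t : ℕ) (S T : Set (Fin n)) (E : Set (Sym2 (Fin n)))
    (hpos : ∃ G ∈ exposureEvent P t S T E, G ∈ μ.support) (v : Fin n),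
    (S = ∅ ∨ v ∈ T \ S) →
    ∃ (α : ℕ) (p : unitInterval), d ≤ α ∧ α ≤ n ∧ (p : ℝ) = d / α ∧
      StochDominated
        ((μ.filter (exposureEvent P t S T E) hpos).map
          fun G => (G.neighborSet v \ S).ncard).toMeasure
        (ProbabilityTheory.binomial α p)

/-! ### The relevant vicinity -/

/-- The rank `(r i, i)` of `i` under the ranking `r`; ranks are compared lexicographically, and
this is the order in which the vertices are arranged. -/
def vertexRank {n L : ℕ} (r : Fin n → Fin L) (i : Fin n) : Fin L ×ₗ Fin n := toLex (r i, i)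

/-- The relevant vicinity of `v`: the least set that contains `v` and, with each of its vertices
`u`, every neighbour of `u` that precedes `u` in the order by rank. -/
def relevantVicinity {n L : ℕ} (G : SimpleGraph (Fin n)) (r : Fin n → Fin L) (v : Fin n) :
    Set (Fin n) :=
  {w | Relation.ReflTransGen
    (fun u w' => G.Adj u w' ∧ vertexRank r w' < vertexRank r u) v w}

/-- The number of edges with at least one endpoint in the relevant vicinity of `v`. -/
noncomputable def vicinityEdgeCount {n L : ℕ} (G : SimpleGraph (Fin n)) (r : Fin n → Fin L)
    (v : Fin n) : ℕ :=
  (incidentEdges G (relevantVicinity G r v)).ncard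

/-! ### Exposing vertices in a prescribed order -/

/-! The relevant vicinity lies in the set reached from `v` along paths of nonincreasing rank, and
the exponential moment of the number of edges at that larger set is bounded first for independent
uniform ranks. Explore it by always exposing a waiting vertex `w` of maximal rank. A vertex
discovered earlier but not put in the queue has rank above some exposed rank, hence above `r w`, and
can never be reached later. So every vertex that `w` adds to the queue is newly discovered, with a
fresh uniform rank, and lightness controls the number of new neighbours.

Give each waiting vertex of rank `a` a weight `m a`. Exposing it costs a factor `exp θ` per new edge
and `m j` per new waiting vertex of rank `j`. By the Poisson-type bound `exp (d * (z - 1))` on the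
generating function, the product of the weights dominates the exponential moment of what remains as
soon as `exp (d * (exp θ * truncatedAverage m a - 1)) ≤ m a` for every `a` (`sum_step_le`,
`sum_exp_incidentEdges_le`). For `d ≥ 1/2` the weights `1 + 2 * 2 ^ j / 2 ^ L` satisfy this because
`L > 24 * d` (`admissible_geometric`). For `d ≤ 1/2` the exploration is subcritical even with a
single rank, so the whole component is bounded without using the hash function.

To pass to the hash family, fix `G`. A distinguisher that queries ranks along the exploration
decides whether the edge count exceeds `t`, unless it runs out of its `k` queries
(`exists_distinguisher`). That failure forces at least `k / 2` edges and has small probability by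
Markov's inequality under truly random ranks. Summing the tails gives the second moment. -/

/-- The list enumerates distinct vertices, each of which (after the first) has a neighbour among
its predecessors. -/
inductive ExposureOrder {V : Type*} (G : SimpleGraph V) : List V → Prop
  | nil : ExposureOrder G []
  | snoc (l : List V) (w : V) : ExposureOrder G l → w ∉ l → (l = [] ∨ ∃ u ∈ l, G.Adj u w) →
      ExposureOrder G (l ++ [w])

/-- The graphs `G` and `G'` have the same neighbourhoods at the vertices of `S`. -/
def AgreeAt {V : Type*} (S : Set V) (G G' : SimpleGraph V) : Prop :=
  ∀ u ∈ S, G'.neighborSet u = G.neighborSet u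

theorem AgreeAt.adj_iff {V : Type*} {S : Set V} {G G' : SimpleGraph V} (h : AgreeAt S G G')
    {u : V} (hu : u ∈ S) (x : V) : G'.Adj u x ↔ G.Adj u x := by
  have := h u hu
  rw [Set.ext_iff] at this
  exact this x

theorem AgreeAt.mono {V : Type*} {S S' : Set V} {G G' : SimpleGraph V} (h : AgreeAt S' G G')
    (hS : S ⊆ S') : AgreeAt S G G' := fun u hu => h u (hS hu)

theorem AgreeAt.incidentEdges_eq {V : Type*} {S : Set V} {G G' : SimpleGraph V}
    (h : AgreeAt S G G') : incidentEdges G' S = incidentEdges G S := by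
  ext e
  induction e with
  | h x y =>
    simp only [incidentEdges, Set.mem_ofPred_eq, SimpleGraph.mem_edgeSet]
    constructor
    · rintro ⟨hxy, u, hu, hue⟩
      refine ⟨?_, u, hu, hue⟩
      rcases Sym2.mem_iff.1 hue with rfl | rfl
      · exact (h.adj_iff hu _).1 hxy
      · exact ((h.adj_iff hu _).1 hxy.symm).symm
    · rintro ⟨hxy, u, hu, hue⟩
      refine ⟨?_, u, hu, hue⟩
      rcases Sym2.mem_iff.1 hue with rfl | rfl
      · exact (h.adj_iff hu _).2 hxy
      · exact ((h.adj_iff hu _).2 hxy.symm).symm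

theorem AgreeAt.outerNeighbors_eq {V : Type*} {S : Set V} {G G' : SimpleGraph V}
    (h : AgreeAt S G G') : outerNeighbors G' S = outerNeighbors G S := by
  ext x
  constructor
  · rintro ⟨hx, w, hw, hwx⟩
    exact ⟨hx, w, hw, (h.adj_iff hw x).1 hwx⟩
  · rintro ⟨hx, w, hw, hwx⟩
    exact ⟨hx, w, hw, (h.adj_iff hw x).2 hwx⟩

theorem agreeAt_of_incidentEdges_eq {V : Type*} {S : Set V} {G G' : SimpleGraph V}
    (h : incidentEdges G' S = incidentEdges G S) : AgreeAt S G G' := by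
  intro u hu
  ext x
  have := Set.ext_iff.1 h s(u, x)
  simp only [incidentEdges, Set.mem_ofPred_eq, SimpleGraph.mem_edgeSet] at this
  have hex : ∃ y ∈ S, y ∈ s(u, x) := ⟨u, hu, Sym2.mem_mk_left u x⟩
  simp only [hex, and_true] at this
  exact this

theorem ExposureOrder.congr {V : Type*} {G G' : SimpleGraph V} {l : List V}
    (hl : ExposureOrder G l) (h : AgreeAt {u | u ∈ l} G G') : ExposureOrder G' l := by
  induction hl with
  | nil => exact .nil
  | snoc l w _ hw hadj ih =>
    refine .snoc l w (ih (h.mono fun u hu => ?_)) hw (hadj.imp id ?_)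
    · exact List.mem_append_left _ hu
    · rintro ⟨u, hu, huw⟩
      exact ⟨u, hu, (h.adj_iff (List.mem_append_left _ hu) w).2 huw⟩

/-- The process is oblivious: it reads its next vertex off `l` by the length of the history, and no
move is void because each vertex is new and adjacent to an earlier one. -/
theorem ExposureOrder.run_eq {V : Type*} {G : SimpleGraph V} {l : List V}
    (hl : ExposureOrder G l) (P : ExposureProcess V)
    (hP : ∀ h : List (V × Set V), h.length < l.length → P h = l[h.length]?) :
    P.run G l.length = l.map fun u => (u, G.neighborSet u) := by
  induction hl with
  | nil => rfl
  | snoc l w _ hw hadj ih =>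
    have ih' := ih fun h hh => by
      rw [hP h (by simp; omega), List.getElem?_append_left hh]
    have hPw : P (l.map fun u => (u, G.neighborSet u)) = some w := by
      rw [hP _ (by simp)]
      simp
    rw [List.length_append, List.length_singleton, ExposureProcess.run]
    simp only [ih', hPw]
    rw [if_pos]
    · simp
    · rcases hadj with rfl | ⟨u, hu, huw⟩
      · exact Or.inl rfl
      · refine Or.inr ⟨fun e he => ?_, (u, G.neighborSet u), ?_, huw⟩
        · rw [ih'] at he
          obtain ⟨x, hx, rfl⟩ := List.mem_map.1 he
          rintro rfl
          exact hw hx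
        · rw [ih']
          exact List.mem_map.2 ⟨u, hu, rfl⟩

/-- Edges at the exposed set determine the neighbourhoods there, and these determine the run. The
conditioning in `IsLight` is thus conditioning on an agreement class, so an adaptive exploration can
be treated one fixed history at a time. -/
theorem ExposureOrder.exposureEvent_eq {V : Type*} {G : SimpleGraph V} {l : List V}
    (hl : ExposureOrder G l) :
    exposureEvent (fun h => l[h.length]?) l.length {u | u ∈ l}
      ({u | u ∈ l} ∪ outerNeighbors G {u | u ∈ l}) (incidentEdges G {u | u ∈ l}) =
      {G' | AgreeAt {u | u ∈ l} G G'} := by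
  ext G'
  constructor
  · rintro ⟨-, -, h⟩
    exact agreeAt_of_incidentEdges_eq h
  · intro h
    refine ⟨?_, ?_, AgreeAt.incidentEdges_eq h⟩
    · unfold ExposureProcess.exposed
      rw [(hl.congr h).run_eq _ fun _ _ => rfl]
      ext v
      simp
    · rw [AgreeAt.outerNeighbors_eq h]

/-! ### Stochastic domination by a binomial law and generating functions -/

/-- A layer-cake formula: for `z ≥ 1` the coefficients are nonnegative, so tail domination passes to
generating functions. The cutoff `m` keeps the sum finite. -/
theorem pow_min_eq_sum (z : ℝ) (m N : ℕ) :
    z ^ min N m = 1 + ∑ j ∈ Finset.range m, (z - 1) * z ^ j * (if j < N then 1 else 0) := by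
  induction m with
  | zero => simp
  | succ m ih =>
    rw [Finset.sum_range_succ, ← add_assoc, ← ih]
    split_ifs with h
    · rw [min_eq_right h, min_eq_right h.le]
      ring
    · rw [min_eq_left (by omega), min_eq_left (by omega)]
      ring

theorem integral_pow_binomial (a : ℕ) (p : unitInterval) (z : ℝ) :
    ∫ x, z ^ x ∂(ProbabilityTheory.binomial a p) = (1 + p * (z - 1)) ^ a := by
  rw [ProbabilityTheory.integral_binomial, show 1 + (p : ℝ) * (z - 1) = p * z + (1 - p) by ring,
    add_pow, ← Nat.range_succ_eq_Iic]
  refine Finset.sum_congr rfl fun k _ => ?_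
  rw [smul_eq_mul, mul_pow]
  ring

theorem binomial_tail_sum_le (a m : ℕ) (p : unitInterval) {z : ℝ} (hz : 1 ≤ z) :
    1 + ∑ j ∈ Finset.range m, (z - 1) * z ^ j *
        (ProbabilityTheory.binomial a p).real {x : ℕ | j < x} ≤
      (1 + p * (z - 1)) ^ a := by
  rw [← integral_pow_binomial]
  have h : ∫ x, z ^ min x m ∂(ProbabilityTheory.binomial a p) ≤
      ∫ x, z ^ x ∂(ProbabilityTheory.binomial a p) :=
    integral_mono (ProbabilityTheory.integrable_binomial _)
      (ProbabilityTheory.integrable_binomial _)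
      fun x => pow_le_pow_right₀ hz (min_le_left _ _)
  refine le_trans (le_of_eq ?_) h
  simp_rw [pow_min_eq_sum]
  rw [integral_add (ProbabilityTheory.integrable_binomial _)
    (ProbabilityTheory.integrable_binomial _), integral_finsetSum _
    fun _ _ => ProbabilityTheory.integrable_binomial _]
  simp only [integral_const, probReal_univ, smul_eq_mul, one_mul]
  congr 1
  refine Finset.sum_congr rfl fun j _ => ?_
  rw [integral_const_mul]
  congr 1
  have : (fun x : ℕ => if j < x then (1 : ℝ) else 0) = Set.indicator {x : ℕ | j < x} 1 := by
    ext x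
    simp [Set.indicator_apply]
  rw [this, integral_indicator_one (Set.to_countable _).measurableSet]

theorem StochDominated.sum_pow_le {α : Type*} [Fintype α] (μ : PMF α) (C : Set α)
    [DecidablePred (· ∈ C)]
    (hC : ∃ a ∈ C, a ∈ μ.support) (f : α → ℕ) (a : ℕ) (p : unitInterval)
    (h : StochDominated ((μ.filter C hC).map f).toMeasure (ProbabilityTheory.binomial a p))
    {z : ℝ} (hz : 1 ≤ z) :
    ∑ x with x ∈ C, (μ x).toReal * z ^ f x ≤
      (1 + p * (z - 1)) ^ a * ∑ x with x ∈ C, (μ x).toReal := by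
  classical
  set s : ℝ := ∑ x with x ∈ C, (μ x).toReal with hs
  have hs0 : 0 ≤ s := Finset.sum_nonneg fun _ _ => ENNReal.toReal_nonneg
  have htail : ∀ j : ℕ, ∑ x with x ∈ C, (μ x).toReal * (if j < f x then 1 else 0) ≤
      (ProbabilityTheory.binomial a p).real {x : ℕ | j < x} * s := by
    intro j
    have h1 := h j
    simp only [Nat.cast_lt] at h1
    rw [PMF.toMeasure_apply_eq_toOuterMeasure_apply _ (Set.to_countable _).measurableSet,
      PMF.toOuterMeasure_map_apply, PMF.toOuterMeasure_apply, tsum_fintype] at h1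
    have h2 := ENNReal.toReal_mono (measure_ne_top _ _) h1
    rw [ENNReal.toReal_sum fun x _ => ne_top_of_le_ne_top ENNReal.one_ne_top
      ((Set.indicator_le_self _ _ _).trans (PMF.coe_le_one _ _))] at h2
    have hsum : (∑' x, C.indicator μ x).toReal = s := by
      rw [tsum_fintype, ENNReal.toReal_sum fun x _ => ne_top_of_le_ne_top ENNReal.one_ne_top
        ((Set.indicator_le_self _ _ _).trans (PMF.coe_le_one _ _)), hs, Finset.sum_filter]
      refine Finset.sum_congr rfl fun x _ => ?_
      by_cases hx : x ∈ C <;> simp [hx]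
    rw [tsum_fintype] at hsum
    have hs1 : 0 < s := by
      obtain ⟨b, hb, hbμ⟩ := hC
      refine lt_of_lt_of_le ?_ (Finset.single_le_sum (fun _ _ => ENNReal.toReal_nonneg)
        (Finset.mem_filter.2 ⟨Finset.mem_univ b, hb⟩))
      exact ENNReal.toReal_pos hbμ (PMF.apply_ne_top _ _)
    rw [← div_le_iff₀ hs1]
    refine le_trans (le_of_eq ?_) h2
    rw [Finset.sum_filter, Finset.sum_div]
    refine Finset.sum_congr rfl fun x _ => ?_
    by_cases hx : x ∈ C <;> by_cases hj : j < f x <;>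
      simp [hx, hj, PMF.filter_apply, hsum, div_eq_mul_inv]
  obtain ⟨m, hm⟩ : ∃ m, ∀ x, f x ≤ m := ⟨∑ x, f x, fun x =>
    Finset.single_le_sum (fun _ _ => Nat.zero_le _) (Finset.mem_univ x)⟩
  calc ∑ x with x ∈ C, (μ x).toReal * z ^ f x
      = ∑ x with x ∈ C, (μ x).toReal * (1 + ∑ j ∈ Finset.range m,
          (z - 1) * z ^ j * (if j < f x then 1 else 0)) := by
        refine Finset.sum_congr rfl fun x _ => ?_
        rw [← pow_min_eq_sum, min_eq_left (hm x)]
    _ = s + ∑ j ∈ Finset.range m, (z - 1) * z ^ j *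
          ∑ x with x ∈ C, (μ x).toReal * (if j < f x then 1 else 0) := by
        simp_rw [mul_add, mul_one, Finset.sum_add_distrib, Finset.mul_sum]
        rw [Finset.sum_comm]
        congr 1
        exact Finset.sum_congr rfl fun _ _ => Finset.sum_congr rfl fun _ _ => by ring
    _ ≤ s + ∑ j ∈ Finset.range m, (z - 1) * z ^ j *
          ((ProbabilityTheory.binomial a p).real {x : ℕ | j < x} * s) := by
        have : 0 ≤ z - 1 := by linarith
        gcongr with j hj
        exact htail j
    _ = (1 + ∑ j ∈ Finset.range m, (z - 1) * z ^ j *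
          (ProbabilityTheory.binomial a p).real {x : ℕ | j < x}) * s := by
        rw [add_mul, one_mul, Finset.sum_mul]
        simp_rw [mul_assoc]
    _ ≤ _ := by
        gcongr
        exact binomial_tail_sum_le a m p hz

/-- Generating function bound for the number of new neighbours in a light distribution. -/
theorem IsLight.sum_pow_le {n : ℕ} {d : ℝ} (hd : 0 < d) {μ : PMF (SimpleGraph (Fin n))}
    (hμ : IsLight d μ) {G : SimpleGraph (Fin n)} {l : List (Fin n)} (hl : ExposureOrder G l)
    {w : Fin n} (hw : w ∉ l) (hw' : l = [] ∨ ∃ u ∈ l, G.Adj u w) {z : ℝ} (hz : 1 ≤ z)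
    [DecidablePred (AgreeAt {u | u ∈ l} G)] :
    ∑ G' with AgreeAt {u | u ∈ l} G G',
        (μ G').toReal * z ^ (G'.neighborSet w \ {u | u ∈ l}).ncard ≤
      Real.exp (d * (z - 1)) * ∑ G' with AgreeAt {u | u ∈ l} G G', (μ G').toReal := by
  classical
  by_cases hpos : ∃ G' ∈ {G' | AgreeAt {u | u ∈ l} G G'}, G' ∈ μ.support
  · have hpos' := hpos
    rw [← hl.exposureEvent_eq] at hpos'
    obtain ⟨a, p, hda, -, hp, hdom⟩ := hμ _ _ _ _ _ hpos' w (by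
      rcases hw' with rfl | ⟨u, hu, huw⟩
      · left
        simp
      · exact Or.inr ⟨Or.inr ⟨hw, u, hu, huw⟩, hw⟩)
    have ha : (0 : ℝ) < a := hd.trans_le hda
    have hdom' : StochDominated ((μ.filter {G' | AgreeAt {u | u ∈ l} G G'} hpos).map
        fun G' => (G'.neighborSet w \ {u | u ∈ l}).ncard).toMeasure
        (ProbabilityTheory.binomial a p) := by
      convert hdom using 4
      exact hl.exposureEvent_eq.symm
    have hmain := hdom'.sum_pow_le μ _ hpos _ a p hz
    refine le_trans (le_of_eq ?_) (hmain.trans ?_)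
    · congr!
    · have hexp : (1 + (p : ℝ) * (z - 1)) ^ a ≤ Real.exp (d * (z - 1)) := by
        have h1 : 1 + (p : ℝ) * (z - 1) ≤ Real.exp (p * (z - 1)) := by
          rw [add_comm]
          exact Real.add_one_le_exp _
        have h0 : 0 ≤ 1 + (p : ℝ) * (z - 1) := by
          have := mul_nonneg p.2.1 (sub_nonneg.2 hz)
          linarith
        refine (pow_le_pow_left₀ h0 h1 a).trans (le_of_eq ?_)
        rw [← Real.exp_nat_mul, hp]
        congr 1
        field_simp
      refine (mul_le_mul_of_nonneg_right hexp
        (Finset.sum_nonneg fun _ _ => ENNReal.toReal_nonneg)).trans (le_of_eq ?_)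
      congr!
  -- On a null class lightness says nothing, but both sides vanish.
  · have h0 : ∀ G', AgreeAt {u | u ∈ l} G G' → (μ G').toReal = 0 := by
      intro G' hG'
      by_contra h
      exact hpos ⟨G', hG', fun h0 => h (by simp [h0])⟩
    rw [Finset.sum_eq_zero, Finset.sum_eq_zero, mul_zero]
    · intro G' hG'
      exact h0 G' (Finset.mem_filter.1 hG').2
    · intro G' hG'
      rw [h0 G' (Finset.mem_filter.1 hG').2, zero_mul]

/-! ### Vicinities and their edge counts -/

/-- The least set that contains `S` and, with each of its vertices `u`, every neighbour of `u`
whose rank is at most that of `u`. -/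
def descendingClosure {V : Type*} {L : ℕ} (G : SimpleGraph V) (r : V → Fin L) (S : Set V) : Set V :=
  {w | ∃ u ∈ S, Relation.ReflTransGen (fun u w => G.Adj u w ∧ r w ≤ r u) u w}

theorem subset_descendingClosure {V : Type*} {L : ℕ} (G : SimpleGraph V) (r : V → Fin L)
    (S : Set V) : S ⊆ descendingClosure G r S := fun u hu => ⟨u, hu, .refl⟩

theorem descendingClosure_subset {V : Type*} {L : ℕ} {G : SimpleGraph V} {r : V → Fin L}
    {S T : Set V} (hST : S ⊆ T) (hT : ∀ u ∈ T, ∀ x, G.Adj u x → r x ≤ r u → x ∈ T) :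
    descendingClosure G r S ⊆ T := by
  rintro w ⟨u, hu, h⟩
  induction h with
  | refl => exact hST hu
  | tail _ h ih => exact hT _ ih _ h.1 h.2

theorem descendingClosure_closed {V : Type*} {L : ℕ} (G : SimpleGraph V) (r : V → Fin L)
    (S : Set V) : ∀ u ∈ descendingClosure G r S, ∀ x, G.Adj u x → r x ≤ r u →
      x ∈ descendingClosure G r S := by
  rintro u ⟨y, hy, h⟩ x hx hr
  exact ⟨y, hy, h.tail ⟨hx, hr⟩⟩

theorem descendingClosure_eq_of_subset {V : Type*} {L : ℕ} {G : SimpleGraph V} {r : V → Fin L}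
    {S T : Set V} (hST : S ⊆ T) (hT : T ⊆ descendingClosure G r S) :
    descendingClosure G r S = descendingClosure G r T :=
  (descendingClosure_subset (hST.trans (subset_descendingClosure _ _ _))
    (descendingClosure_closed _ _ _)).antisymm
  (descendingClosure_subset hT (descendingClosure_closed _ _ _))

theorem incidentEdges_mono {V : Type*} (G : SimpleGraph V) {S T : Set V} (h : S ⊆ T) :
    incidentEdges G S ⊆ incidentEdges G T := fun _ ⟨he, u, hu, hue⟩ => ⟨he, u, h hu, hue⟩

/-- Each edge is charged to whichever of its endpoints is exposed first. -/
theorem ncard_incidentEdges_insert {V : Type*} [Finite V] (G : SimpleGraph V) {S : Set V} {w : V}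
    (hw : w ∉ S) : (incidentEdges G (insert w S)).ncard =
      (incidentEdges G S).ncard + (G.neighborSet w \ S).ncard := by
  have h1 : incidentEdges G (insert w S) =
      incidentEdges G S ∪ (fun x => s(w, x)) '' (G.neighborSet w \ S) := by
    ext e
    constructor
    · rintro ⟨he, u, hu, hue⟩
      rcases hu with rfl | hu
      · obtain ⟨x, rfl⟩ := hue
        by_cases hx : x ∈ S
        · exact Or.inl ⟨he, x, hx, Sym2.mem_mk_right _ _⟩
        · exact Or.inr ⟨x, ⟨he, hx⟩, rfl⟩
      · exact Or.inl ⟨he, u, hu, hue⟩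
    · rintro (⟨he, u, hu, hue⟩ | ⟨x, ⟨hx, -⟩, rfl⟩)
      · exact ⟨he, u, Set.mem_insert_of_mem _ hu, hue⟩
      · exact ⟨hx, w, Set.mem_insert _ _, Sym2.mem_mk_left _ _⟩
  rw [h1, Set.ncard_union_eq, Set.ncard_image_of_injective]
  · intro x y hxy
    simp only [Sym2.eq_iff, true_and] at hxy
    rcases hxy with h | ⟨rfl, rfl⟩
    · exact h
    · rfl
  · rw [Set.disjoint_left]
    rintro _ ⟨-, u, hu, hue⟩ ⟨x, ⟨-, hx⟩, rfl⟩
    rcases Sym2.mem_iff.1 hue with rfl | rfl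
    · exact hw hu
    · exact hx hu

/-! ### Finite sums -/

/-- Plays the role of the tower property; with unnormalised sums, classes of mass zero need no
separate treatment. -/
theorem Finset.sum_le_sum_of_fibers {α β : Type*} [DecidableEq β] (s : Finset α) (φ : α → β)
    (f g : α → ℝ)
    (h : ∀ a ∈ s, ∑ b ∈ s with φ b = φ a, f b ≤ ∑ b ∈ s with φ b = φ a, g b) :
    ∑ a ∈ s, f a ≤ ∑ a ∈ s, g a := by
  rw [← Finset.sum_fiberwise_of_maps_to (g := φ) (t := s.image φ)
    fun a ha => Finset.mem_image_of_mem φ ha,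
    ← Finset.sum_fiberwise_of_maps_to (g := φ) (t := s.image φ) (f := g)
    fun a ha => Finset.mem_image_of_mem φ ha]
  refine Finset.sum_le_sum fun b hb => ?_
  obtain ⟨a, ha, rfl⟩ := Finset.mem_image.1 hb
  exact h a ha

open Classical in
/-- Averaging a product over the functions with prescribed values on `T`. -/
theorem sum_prod_eq_card_mul_pow {n L : ℕ}
    (T : Set (Fin n)) (r : Fin n → Fin L) (B : Finset (Fin n)) (hB : ∀ x ∈ B, x ∉ T)
    (g : Fin L → ℝ) :
    ∑ r' : Fin n → Fin L with ∀ x ∈ T, r' x = r x, ∏ x ∈ B, g (r' x) =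
      (Finset.univ.filter fun r' : Fin n → Fin L => ∀ x ∈ T, r' x = r x).card *
        ((∑ j, g j) / L) ^ B.card := by
  set t : Fin n → Finset (Fin L) := fun x => if x ∈ T then {r x} else Finset.univ with ht
  have h1 : (Finset.univ.filter fun r' : Fin n → Fin L => ∀ x ∈ T, r' x = r x) =
      Fintype.piFinset t := by
    ext r'
    simp only [Finset.mem_filter, Finset.mem_univ, true_and, Fintype.mem_piFinset, ht]
    refine forall_congr' fun x => ?_
    by_cases hx : x ∈ T <;> simp [hx]
  have h2 : ∀ r' : Fin n → Fin L, ∏ x ∈ B, g (r' x) = ∏ x, if x ∈ B then g (r' x) else 1 := by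
    intro r'
    rw [Finset.prod_ite_mem, Finset.univ_inter]
  have h3 : ((∑ j, g j) / L) ^ B.card = ∏ x, if x ∈ B then (∑ j, g j) / (L : ℝ) else 1 := by
    rw [Finset.prod_ite_mem, Finset.univ_inter, Finset.prod_const]
  rw [Finset.sum_congr h1 fun r' _ => h2 r', h1,
    ← Finset.prod_univ_sum t fun x j => if x ∈ B then g j else 1, Fintype.card_piFinset, h3,
    Nat.cast_prod, ← Finset.prod_mul_distrib]
  refine Finset.prod_congr rfl fun x _ => ?_
  have hL : (L : ℝ) ≠ 0 := by
    have := (r x).pos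
    positivity
  by_cases hx : x ∈ B
  · simp only [hx, if_true, ht, hB x hx, if_false, Finset.card_univ, Fintype.card_fin]
    field_simp
  · simp [hx]

/-! ### Exploring a vicinity in the order of decreasing ranks -/

/-- The invariant of the exploration: the vertices of `l` are exposed, those of `Q` are waiting. -/
structure ExplorationState {V : Type*} {L : ℕ} (G : SimpleGraph V) (r : V → Fin L) (l : List V)
    (Q : Finset V) : Prop where
  order : ExposureOrder G l
  notMem : ∀ q ∈ Q, q ∉ l
  adj : (l = [] ∧ ∀ q ∈ Q, ∀ q' ∈ Q, q = q') ∨ ∀ q ∈ Q, ∃ u ∈ l, G.Adj u q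
  rank_le : ∀ u ∈ l, ∀ q ∈ Q, r q ≤ r u
  closed : ∀ u ∈ l, ∀ x ∉ l, G.Adj u x → r x ≤ r u → x ∈ Q

/-- The vertices discovered by the exploration. -/
def discovered {V : Type*} (G : SimpleGraph V) (l : List V) (Q : Finset V) : Set V :=
  {x | x ∈ l ∨ (∃ u ∈ l, G.Adj u x) ∨ x ∈ Q}

open Classical in
/-- The pairs of a graph and a ranking that look the same to the exploration. -/
noncomputable def indistinguishable {n L : ℕ} (G : SimpleGraph (Fin n))
    (r : Fin n → Fin L) (l : List (Fin n)) (Q : Finset (Fin n)) :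
    Finset (SimpleGraph (Fin n) × (Fin n → Fin L)) :=
  (Finset.univ.filter (AgreeAt {u | u ∈ l} G)) ×ˢ
    (Finset.univ.filter fun r' => ∀ x ∈ discovered G l Q, r' x = r x)

theorem mem_indistinguishable {n L : ℕ} {G : SimpleGraph (Fin n)}
    {r : Fin n → Fin L} {l : List (Fin n)} {Q : Finset (Fin n)}
    {p : SimpleGraph (Fin n) × (Fin n → Fin L)} :
    p ∈ indistinguishable G r l Q ↔
      AgreeAt {u | u ∈ l} G p.1 ∧ ∀ x ∈ discovered G l Q, p.2 x = r x := by
  simp [indistinguishable]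

open Classical in
/-- The waiting vertices after the exposure of `w`. -/
noncomputable def nextQueue {n L : ℕ} (T : Set (Fin n)) (Q : Finset (Fin n)) (w : Fin n)
    (G : SimpleGraph (Fin n)) (r : Fin n → Fin L) : Finset (Fin n) :=
  Finset.univ.filter fun x => (x ≠ w ∧ x ∈ Q) ∨ (G.Adj w x ∧ x ∉ T ∧ r x ≤ r w)

theorem mem_nextQueue {n L : ℕ} {T : Set (Fin n)} {Q : Finset (Fin n)} {w : Fin n}
    {G : SimpleGraph (Fin n)} {r : Fin n → Fin L} {x : Fin n} : x ∈ nextQueue T Q w G r ↔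
      (x ≠ w ∧ x ∈ Q) ∨ (G.Adj w x ∧ x ∉ T ∧ r x ≤ r w) := by
  simp [nextQueue]

theorem discovered_next {n L : ℕ} {G G' : SimpleGraph (Fin n)}
    {r' : Fin n → Fin L} {l : List (Fin n)} {Q : Finset (Fin n)} {w : Fin n} (hw : w ∈ Q)
    (hG : AgreeAt {u | u ∈ l} G G') :
    discovered G' (l ++ [w]) (nextQueue (discovered G l Q) Q w G' r') =
      discovered G l Q ∪ G'.neighborSet w := by
  ext x
  have hN : (∃ u ∈ l, G'.Adj u x) ↔ ∃ u ∈ l, G.Adj u x :=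
    exists_congr fun u => and_congr_right fun hu => hG.adj_iff hu x
  simp only [discovered, Set.mem_ofPred_eq, List.mem_append, List.mem_singleton, mem_nextQueue,
    Set.mem_union, SimpleGraph.mem_neighborSet, or_and_right, exists_or, exists_eq_left, hN]
  by_cases hxw : x = w
  · subst hxw
    tauto
  · simp only [hxw, ne_eq, not_false_eq_true, true_and, or_false]
    generalize (∃ u ∈ l, G.Adj u x) = p
    tauto

/-- Maximality of `r w` keeps every waiting rank below all exposed ranks, which is what permits
ignoring vertices discovered before. -/
theorem ExplorationState.next {n L : ℕ} {G : SimpleGraph (Fin n)}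
    {r : Fin n → Fin L} {l : List (Fin n)} {Q : Finset (Fin n)} (h : ExplorationState G r l Q)
    {w : Fin n}
    (hw : w ∈ Q) (hmax : ∀ q ∈ Q, r q ≤ r w) {p : SimpleGraph (Fin n) × (Fin n → Fin L)}
    (hp : p ∈ indistinguishable G r l Q) :
    ExplorationState p.1 p.2 (l ++ [w]) (nextQueue (discovered G l Q) Q w p.1 p.2) := by
  obtain ⟨hG, hr⟩ := mem_indistinguishable.1 hp
  have hrl : ∀ u ∈ l, p.2 u = r u := fun u hu => hr u (Or.inl hu)
  have hrQ : ∀ u ∈ Q, p.2 u = r u := fun u hu => hr u (Or.inr (Or.inr hu))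
  have hadj : ∀ u ∈ l, ∀ x, p.1.Adj u x ↔ G.Adj u x := fun u hu => hG.adj_iff hu
  have hlT : ∀ u ∈ l, u ∈ discovered G l Q := fun u hu => Or.inl hu
  refine ⟨.snoc l w (h.order.congr hG) (h.notMem w hw) ?_, ?_, ?_, ?_, ?_⟩
  · refine h.adj.imp And.left fun h' => ?_
    obtain ⟨u, hu, huw⟩ := h' w hw
    exact ⟨u, hu, (hadj u hu w).2 huw⟩
  · intro q hq hql
    rw [List.mem_append, List.mem_singleton] at hql
    rcases mem_nextQueue.1 hq with ⟨hqw, hqQ⟩ | ⟨hwq, hqT, -⟩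
    · exact hql.elim (h.notMem q hqQ) hqw
    · rcases hql with hql | rfl
      · exact hqT (hlT q hql)
      · exact p.1.loopless.irrefl _ hwq
  · right
    intro q hq
    rcases mem_nextQueue.1 hq with ⟨hqw, hqQ⟩ | ⟨hwq, -⟩
    · rcases h.adj with ⟨-, h'⟩ | h'
      · exact absurd (h' q hqQ w hw) hqw
      · obtain ⟨u, hu, huq⟩ := h' q hqQ
        exact ⟨u, List.mem_append_left _ hu, (hadj u hu q).2 huq⟩
    · exact ⟨w, by simp, hwq⟩
  · intro u hu q hq
    rw [List.mem_append, List.mem_singleton] at hu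
    have hwu : p.2 w ≤ p.2 u := by
      rcases hu with hu | rfl
      · rw [hrl u hu, hrQ w hw]
        exact h.rank_le u hu w hw
      · exact le_rfl
    refine le_trans ?_ hwu
    rcases mem_nextQueue.1 hq with ⟨hqw, hqQ⟩ | ⟨-, -, hle⟩
    · rw [hrQ q hqQ, hrQ w hw]
      exact hmax q hqQ
    · exact hle
  · intro u hu x hx hux hle
    rw [List.mem_append, List.mem_singleton, not_or] at hx
    rw [List.mem_append, List.mem_singleton] at hu
    rw [mem_nextQueue]
    rcases hu with hu | rfl
    · have hux' := (hadj u hu x).1 hux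
      rw [hrl u hu, hr x (Or.inr (Or.inl ⟨u, hu, hux'⟩))] at hle
      exact Or.inl ⟨hx.2, h.closed u hu x hx.1 hux' hle⟩
    · by_cases hxT : x ∈ discovered G l Q
      · left
        refine ⟨hx.2, ?_⟩
        -- If `x` was discovered from `u'`, then `r x ≤ r w ≤ r u'`, so `x` was already queued.
        rcases id hxT with hxl | ⟨u', hu', hux'⟩ | hxQ
        · exact absurd hxl hx.1
        · refine h.closed u' hu' x hx.1 hux' ?_
          rw [hr x hxT, hrQ u hw] at hle
          exact hle.trans (h.rank_le u' hu' u hw)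
        · exact hxQ
      · exact Or.inr ⟨hux, hxT, hle⟩

/-- The average over a uniform rank `j` of `m j` if `j ≤ a`, and of `1` otherwise. -/
noncomputable def truncatedAverage {L : ℕ} (m : Fin L → ℝ) (a : Fin L) : ℝ :=
  (∑ j, if j ≤ a then m j else 1) / L

theorem one_le_truncatedAverage {L : ℕ} {m : Fin L → ℝ} (hm : ∀ j, 1 ≤ m j) (a : Fin L) :
    1 ≤ truncatedAverage m a := by
  have hL : (0 : ℝ) < L := by exact_mod_cast a.pos
  rw [truncatedAverage, le_div_iff₀ hL, one_mul]
  calc (L : ℝ) = ∑ j : Fin L, (1 : ℝ) := by simp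
    _ ≤ _ := Finset.sum_le_sum fun j _ => by
      split_ifs
      exacts [hm j, le_rfl]

open Classical in
-- Revealing the neighbourhood of `w` and the ranks of its neighbours splits a class into classes of
-- the same shape, to which an induction hypothesis applies.
theorem filter_indistinguishable_eq {n L : ℕ} {G : SimpleGraph (Fin n)}
    {r : Fin n → Fin L} {l : List (Fin n)} {Q : Finset (Fin n)} {w : Fin n} (hw : w ∈ Q)
    {p : SimpleGraph (Fin n) × (Fin n → Fin L)} (hp : p ∈ indistinguishable G r l Q)
    (φ : SimpleGraph (Fin n) × (Fin n → Fin L) → Set (Fin n) × Set (Fin n × Fin L))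
    (hφ : ∀ p, φ p = (p.1.neighborSet w,
      {q | q.1 ∈ discovered G l Q ∪ p.1.neighborSet w ∧ p.2 q.1 = q.2})) :
    (indistinguishable G r l Q).filter (fun p' => φ p' = φ p) =
      indistinguishable p.1 p.2 (l ++ [w]) (nextQueue (discovered G l Q) Q w p.1 p.2) := by
  obtain ⟨hG, hr⟩ := mem_indistinguishable.1 hp
  ext p'
  rw [Finset.mem_filter, mem_indistinguishable, mem_indistinguishable, discovered_next hw hG,
    hφ, hφ, Prod.mk.injEq]
  constructor
  · rintro ⟨⟨hG', hr'⟩, hN, hrr⟩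
    refine ⟨fun u hu => ?_, fun x hx => ?_⟩
    · rcases List.mem_append.1 hu with hu | hu
      · rw [hG' u hu, hG u hu]
      · rw [List.mem_singleton.1 hu, hN]
    · rw [hN] at hrr
      exact ((Set.ext_iff.1 hrr (x, p.2 x)).2 ⟨hx, rfl⟩).2
  · rintro ⟨hG', hr'⟩
    have hN : p'.1.neighborSet w = p.1.neighborSet w := hG' w (by simp)
    refine ⟨⟨fun u hu => ?_, fun x hx => ?_⟩, hN, ?_⟩
    · rw [hG' u (List.mem_append_left _ hu), hG u hu]
    · rw [hr' x (Or.inl hx), hr x hx]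
    · rw [hN]
      ext q
      exact and_congr_right fun hx => by rw [hr' _ hx]

theorem descendingClosure_union_eq_next {n L : ℕ} {l : List (Fin n)}
    {Q : Finset (Fin n)} {w : Fin n} (hw : w ∈ Q) {T : Set (Fin n)} {G G' : SimpleGraph (Fin n)}
    {r r' : Fin n → Fin L}
    (hG : ∀ x, G.Adj w x → G'.Adj w x) (hr : ∀ x, G.Adj w x → r x ≤ r w → r' x ≤ r' w) :
    descendingClosure G' r' ({u | u ∈ l} ∪ Q) =
      descendingClosure G' r' ({u | u ∈ l ++ [w]} ∪ (nextQueue T Q w G r : Finset (Fin n))) := by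
  classical
  apply descendingClosure_eq_of_subset
  · rintro x (hx | hx)
    · exact Or.inl (List.mem_append_left _ hx)
    · by_cases hxw : x = w
      · exact Or.inl (by simp [hxw])
      · exact Or.inr (Finset.mem_coe.2 (mem_nextQueue.2 (Or.inl ⟨hxw, hx⟩)))
  · have hwc : w ∈ descendingClosure G' r' ({u | u ∈ l} ∪ Q) :=
      subset_descendingClosure _ _ _ (Or.inr hw)
    rintro x (hx | hx)
    · rcases List.mem_append.1 hx with hx | hx
      · exact subset_descendingClosure _ _ _ (Or.inl hx)
      · rw [List.mem_singleton.1 hx]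
        exact hwc
    · rcases mem_nextQueue.1 (Finset.mem_coe.1 hx) with ⟨-, hxQ⟩ | ⟨hwx, -, hle⟩
      · exact subset_descendingClosure _ _ _ (Or.inr hxQ)
      · exact descendingClosure_closed _ _ _ w hwc x (hG x hwx) (hr x hwx hle)

open Classical in
/-- One exposure step, averaged over the unknown part of the graph and of the ranking. -/
theorem sum_step_le {n L : ℕ} {d θ : ℝ} (hd : 0 < d) (hθ : 0 ≤ θ)
    {μ : PMF (SimpleGraph (Fin n))} (hμ : IsLight d μ) {m : Fin L → ℝ} (hm : ∀ j, 1 ≤ m j)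
    (hsup : ∀ a, Real.exp (d * (Real.exp θ * truncatedAverage m a - 1)) ≤ m a)
    {G : SimpleGraph (Fin n)} {r : Fin n → Fin L} {l : List (Fin n)} {Q : Finset (Fin n)}
    (h : ExplorationState G r l Q) {w : Fin n} (hw : w ∈ Q) :
    ∑ p ∈ indistinguishable G r l Q, (μ p.1).toReal *
        (Real.exp (θ * (p.1.neighborSet w \ {u | u ∈ l}).ncard) *
          ∏ x with p.1.Adj w x ∧ x ∉ discovered G l Q, if p.2 x ≤ r w then m (p.2 x) else 1) ≤
      m (r w) * ∑ p ∈ indistinguishable G r l Q, (μ p.1).toReal := by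
  set z := Real.exp θ * truncatedAverage m (r w) with hz
  have ha1 := one_le_truncatedAverage hm (r w)
  have hz1 : 1 ≤ z := one_le_mul_of_one_le_of_one_le (Real.one_le_exp hθ) ha1
  set R := Finset.univ.filter fun r' : Fin n → Fin L => ∀ x ∈ discovered G l Q, r' x = r x with hR
  have hadj : l = [] ∨ ∃ u ∈ l, G.Adj u w := h.adj.imp And.left fun h' => h' w hw
  have hlight := IsLight.sum_pow_le hd hμ h.order (h.notMem w hw) hadj hz1
  unfold indistinguishable
  rw [Finset.sum_product, Finset.sum_product]
  calc _ ≤ ∑ G' with AgreeAt {u | u ∈ l} G G',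
        R.card * ((μ G').toReal * z ^ (G'.neighborSet w \ {u | u ∈ l}).ncard) := by
        refine Finset.sum_le_sum fun G' _ => ?_
        have hinner := sum_prod_eq_card_mul_pow (discovered G l Q) r
          (Finset.univ.filter fun x => G'.Adj w x ∧ x ∉ discovered G l Q)
          (fun x hx => (Finset.mem_filter.1 hx).2.2) fun j => if j ≤ r w then m j else 1
        rw [← hR] at hinner
        dsimp only
        rw [← hR, ← Finset.mul_sum, ← Finset.mul_sum, hinner]
        -- Neighbours of `w` that are discovered but unexposed give an edge and no fresh rank. Since
        -- the average is at least `1`, charging them the full factor `z` is harmless.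
        have hcard : (Finset.univ.filter fun x => G'.Adj w x ∧ x ∉ discovered G l Q).card ≤
            (G'.neighborSet w \ {u | u ∈ l}).ncard := by
          rw [← Set.ncard_coe_finset]
          refine Set.ncard_le_ncard ?_ (Set.toFinite _)
          intro x hx
          obtain ⟨-, hx1, hx2⟩ := Finset.mem_filter.1 (Finset.mem_coe.1 hx)
          exact ⟨hx1, fun hxl => hx2 (Or.inl hxl)⟩
        have hpow := pow_le_pow_right₀ ha1 hcard
        rw [hz, mul_pow, ← Real.exp_nat_mul, mul_comm _ θ]
        calc _ ≤ (μ G').toReal * (Real.exp (θ * (G'.neighborSet w \ {u | u ∈ l}).ncard) *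
              (R.card * truncatedAverage m (r w) ^ (G'.neighborSet w \ {u | u ∈ l}).ncard)) := by
              gcongr
              exact hpow
          _ = _ := by ring
    _ = R.card * ∑ G' with AgreeAt {u | u ∈ l} G G',
        (μ G').toReal * z ^ (G'.neighborSet w \ {u | u ∈ l}).ncard := by rw [Finset.mul_sum]
    _ ≤ R.card * (m (r w) * ∑ G' with AgreeAt {u | u ∈ l} G G', (μ G').toReal) := by
        gcongr
        refine hlight.trans ?_
        gcongr
        exact hsup (r w)
    _ = _ := by
        simp only [Finset.sum_const, nsmul_eq_mul, ← Finset.mul_sum]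
        ring

open Classical in
/-- The generating function of the number of edges at the vicinity still to be explored. -/
theorem sum_exp_incidentEdges_le {n L : ℕ} {d θ : ℝ} (hd : 0 < d) (hθ : 0 ≤ θ)
    {μ : PMF (SimpleGraph (Fin n))} (hμ : IsLight d μ) {m : Fin L → ℝ} (hm : ∀ j, 1 ≤ m j)
    (hsup : ∀ a, Real.exp (d * (Real.exp θ * truncatedAverage m a - 1)) ≤ m a) (N : ℕ) :
    ∀ (G : SimpleGraph (Fin n)) (r : Fin n → Fin L) (l : List (Fin n)) (Q : Finset (Fin n)),
      ExplorationState G r l Q → (Finset.univ.filter (· ∉ l)).card ≤ N →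
      ∑ p ∈ indistinguishable G r l Q, (μ p.1).toReal *
          Real.exp (θ * (incidentEdges p.1
            (descendingClosure p.1 p.2 ({u | u ∈ l} ∪ Q))).ncard) ≤
        Real.exp (θ * (incidentEdges G {u | u ∈ l}).ncard) * (∏ q ∈ Q, m (r q)) *
          ∑ p ∈ indistinguishable G r l Q, (μ p.1).toReal := by
  -- With nothing waiting, the exposed set is already closed and equality holds.
  have hempty : ∀ (G : SimpleGraph (Fin n)) (r : Fin n → Fin L) (l : List (Fin n)),
      ExplorationState G r l ∅ →
      ∑ p ∈ indistinguishable G r l ∅, (μ p.1).toReal *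
          Real.exp (θ * (incidentEdges p.1 (descendingClosure p.1 p.2
            ({u | u ∈ l} ∪ ((∅ : Finset (Fin n)) : Set (Fin n))))).ncard) ≤
        Real.exp (θ * (incidentEdges G {u | u ∈ l}).ncard) * (∏ q ∈ ∅, m (r q)) *
          ∑ p ∈ indistinguishable G r l ∅, (μ p.1).toReal := by
    intro G r l h
    rw [Finset.prod_empty, mul_one, Finset.mul_sum]
    refine le_of_eq (Finset.sum_congr rfl fun p hp => ?_)
    obtain ⟨hG, hr⟩ := mem_indistinguishable.1 hp
    have hcl : descendingClosure p.1 p.2 ({u | u ∈ l} ∪ ((∅ : Finset (Fin n)) : Set (Fin n))) =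
        {u | u ∈ l} := by
      refine subset_antisymm (descendingClosure_subset (by simp) fun u hu x hx hle => ?_)
        (Set.subset_union_left.trans (subset_descendingClosure _ _ _))
      by_contra hxl
      have hux := (hG.adj_iff hu x).1 hx
      rw [hr u (Or.inl hu), hr x (Or.inr (Or.inl ⟨u, hu, hux⟩))] at hle
      exact Finset.notMem_empty x (h.closed u hu x hxl hux hle)
    rw [hcl, hG.incidentEdges_eq, mul_comm]
  induction N with
  | zero =>
    intro G r l Q h hN
    have hQ : Q = ∅ := by
      refine Finset.eq_empty_of_forall_notMem fun q hq => ?_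
      have : q ∈ Finset.univ.filter (· ∉ l) := by simpa using h.notMem q hq
      rw [Finset.card_eq_zero.1 (Nat.le_zero.1 hN)] at this
      exact Finset.notMem_empty q this
    subst hQ
    exact hempty G r l h
  | succ N ih =>
    intro G r l Q h hN
    rcases Q.eq_empty_or_nonempty with rfl | hQ
    · exact hempty G r l h
    obtain ⟨w, hw, hmax⟩ := Q.exists_max_image r hQ
    have hwl := h.notMem w hw
    set T := discovered G l Q with hT
    set φ : SimpleGraph (Fin n) × (Fin n → Fin L) → Set (Fin n) × Set (Fin n × Fin L) :=
      fun p => (p.1.neighborSet w,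
        {q | q.1 ∈ discovered G l Q ∪ p.1.neighborSet w ∧ p.2 q.1 = q.2}) with hφ
    set K := Real.exp (θ * (incidentEdges G {u | u ∈ l}).ncard) * ∏ q ∈ Q.erase w, m (r q)
      with hK
    have hK0 : 0 ≤ K := by
      have : ∀ j, 0 ≤ m j := fun j => zero_le_one.trans (hm j)
      exact mul_nonneg (Real.exp_nonneg _) (Finset.prod_nonneg fun _ _ => this _)
    have hstep := mul_le_mul_of_nonneg_left (sum_step_le hd hθ hμ hm hsup h hw) hK0
    rw [← Finset.mul_prod_erase Q _ hw]
    refine le_trans ?_ (hstep.trans (le_of_eq (by rw [hK]; ring)))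
    rw [Finset.mul_sum]
    -- It remains to bound each outcome of exposing `w` by the induction hypothesis; `hstep` has
    -- averaged the resulting bounds.
    refine Finset.sum_le_sum_of_fibers _ φ _ _ fun p hp => ?_
    rw [filter_indistinguishable_eq hw hp φ fun _ => rfl]
    obtain ⟨hG, hr⟩ := mem_indistinguishable.1 hp
    have hst := h.next hw hmax hp
    have hlt : (Finset.univ.filter (· ∉ l ++ [w])).card ≤ N := by
      refine Nat.lt_succ_iff.1 (lt_of_lt_of_le (Finset.card_lt_card ?_) hN)
      refine Finset.ssubset_iff_subset_ne.2 ⟨?_, ?_⟩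
      · intro x
        simp +contextual
      · intro heq
        have : w ∈ Finset.univ.filter (· ∉ l) := by simpa using hwl
        rw [← heq] at this
        simp at this
    have hih := ih _ _ _ _ hst hlt
    set Q' := nextQueue (discovered G l Q) Q w p.1 p.2 with hQ'
    have hdisc := discovered_next (r' := p.2) hw hG
    refine le_trans (le_of_eq ?_) (hih.trans (le_of_eq ?_))
    · refine Finset.sum_congr rfl fun p' hp' => ?_
      obtain ⟨hG', hr'⟩ := mem_indistinguishable.1 hp'
      rw [hdisc] at hr'
      have hw' : p'.2 w = p.2 w := hr' w (Or.inl (Or.inr (Or.inr hw)))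
      have hNw := hG'.adj_iff (u := w) (by simp)
      rw [descendingClosure_union_eq_next hw (T := T) (G := p.1) (r := p.2)
        (fun x hx => (hNw x).2 hx)
        (fun x hx hle => by rw [hw', hr' x (Or.inr hx)]; exact hle)]
    · rw [Finset.mul_sum]
      refine Finset.sum_congr rfl fun p' hp' => ?_
      obtain ⟨hG', hr'⟩ := mem_indistinguishable.1 hp'
      rw [hdisc] at hr'
      have hNw : p'.1.neighborSet w = p.1.neighborSet w := hG' w (by simp)
      have hNw' := hG'.adj_iff (u := w) (by simp)
      have hins : {u | u ∈ l ++ [w]} = insert w {u | u ∈ l} := by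
        ext u
        simp [or_comm]
      have hinc : ((incidentEdges p.1 {u | u ∈ l ++ [w]}).ncard : ℝ) =
          (incidentEdges G {u | u ∈ l}).ncard + (p'.1.neighborSet w \ {u | u ∈ l}).ncard := by
        rw [hins, ncard_incidentEdges_insert _ (by exact hwl), hG.incidentEdges_eq, hNw]
        push_cast
        rfl
      -- The new queue is the old one without `w`, plus newly discovered neighbours of rank at most
      -- `r w`; the other new neighbours contribute `1`.
      have hprod : ∏ q ∈ Q', m (p.2 q) = (∏ q ∈ Q.erase w, m (r q)) *
          ∏ x with p'.1.Adj w x ∧ x ∉ discovered G l Q,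
            if p'.2 x ≤ r w then m (p'.2 x) else 1 := by
        have hQe : Q' = Q.erase w ∪ Finset.univ.filter fun x => p.1.Adj w x ∧
            x ∉ discovered G l Q ∧ p.2 x ≤ p.2 w := by
          ext x
          rw [hQ', mem_nextQueue]
          simp
        rw [hQe, Finset.prod_union]
        · congr 1
          · refine Finset.prod_congr rfl fun q hq => ?_
            rw [hr q (Or.inr (Or.inr (Finset.mem_of_mem_erase hq)))]
          · rw [← Finset.prod_filter, Finset.filter_filter]
            have hrw : p.2 w = r w := hr w (Or.inr (Or.inr hw))
            refine Finset.prod_congr ?_ ?_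
            · ext x
              simp only [Finset.mem_filter, Finset.mem_univ, true_and, hNw', hrw, and_assoc]
              refine and_congr_right fun hx => ?_
              rw [hr' x (Or.inr hx)]
            · intro x hx
              rw [hr' x (Or.inr ((hNw' x).1 (Finset.mem_filter.1 hx).2.1.1))]
        · rw [Finset.disjoint_left]
          intro x hx hx'
          exact (Finset.mem_filter.1 hx').2.2.1 (Or.inr (Or.inr (Finset.mem_of_mem_erase hx)))
      rw [hinc, hprod, mul_add, Real.exp_add, hK]
      ring

/-! ### The descending edge count and its exponential moment -/

/-- The number of edges with an endpoint in the set of vertices that are reached from `v` along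
paths on which the ranks never increase. -/
noncomputable def descendingEdgeCount {V : Type*} {L : ℕ} (G : SimpleGraph V) (r : V → Fin L)
    (v : V) : ℕ :=
  (incidentEdges G (descendingClosure G r {v})).ncard

/-- A lexicographic descent never increases the first coordinate; following all ties only enlarges
the set. -/
theorem vicinityEdgeCount_le {n L : ℕ} (G : SimpleGraph (Fin n)) (r : Fin n → Fin L) (v : Fin n) :
    vicinityEdgeCount G r v ≤ descendingEdgeCount G r v := by
  refine Set.ncard_le_ncard (incidentEdges_mono G ?_) (Set.toFinite _)
  intro w hw
  refine ⟨v, rfl, Relation.ReflTransGen.mono (fun a b hab => ⟨hab.1, ?_⟩) _ _ hw⟩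
  have := hab.2
  rw [vertexRank, vertexRank, Prod.Lex.toLex_lt_toLex] at this
  exact this.elim le_of_lt fun h => h.1.le

/-- With a single rank the closure is the whole component of `v`. -/
theorem descendingEdgeCount_le_const {n L : ℕ} (G : SimpleGraph (Fin n)) (r : Fin n → Fin L)
    (r' : Fin n → Fin 1) (v : Fin n) :
    descendingEdgeCount G r v ≤ descendingEdgeCount G r' v := by
  refine Set.ncard_le_ncard (incidentEdges_mono G ?_) (Set.toFinite _)
  rintro w ⟨u, hu, hw⟩
  exact ⟨u, hu, Relation.ReflTransGen.mono
    (fun a b hab => ⟨hab.1, (Subsingleton.elim _ _).le⟩) _ _ hw⟩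

theorem descendingEdgeCount_le_sq {n L : ℕ} (G : SimpleGraph (Fin n)) (r : Fin n → Fin L)
    (v : Fin n) : descendingEdgeCount G r v ≤ n ^ 2 := by
  classical
  have h1 : (incidentEdges G (descendingClosure G r {v})).ncard ≤
      ((fun p : Fin n × Fin n => s(p.1, p.2)) '' Set.univ).ncard := by
    refine Set.ncard_le_ncard ?_ (Set.toFinite _)
    intro e _
    induction e with
    | h x y => exact ⟨(x, y), trivial, rfl⟩
  refine h1.trans ((Set.ncard_image_le (Set.toFinite _)).trans (le_of_eq ?_))
  rw [Set.ncard_univ, Nat.card_eq_fintype_card]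
  simp [sq]

theorem sum_toReal_eq_one {α : Type*} [Fintype α] (μ : PMF α) : ∑ a, (μ a).toReal = 1 := by
  rw [← ENNReal.toReal_sum fun a _ => PMF.apply_ne_top _ _, ← tsum_fintype (L := .unconditional _),
    PMF.tsum_coe, ENNReal.toReal_one]

/-- The generating function of the edge count at a vertex, for independent uniform ranks. -/
theorem sum_exp_descendingEdgeCount_le {n L : ℕ} {d θ M : ℝ} (hL : 0 < L) (hd : 0 < d) (hθ : 0 ≤ θ)
    {μ : PMF (SimpleGraph (Fin n))} (hμ : IsLight d μ) {m : Fin L → ℝ} (hm : ∀ j, 1 ≤ m j)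
    (hM : ∀ j, m j ≤ M)
    (hsup : ∀ a, Real.exp (d * (Real.exp θ * truncatedAverage m a - 1)) ≤ m a) (v : Fin n) :
    ∑ G : SimpleGraph (Fin n), (μ G).toReal *
      uniformExpect (fun r : Fin n → Fin L => Real.exp (θ * descendingEdgeCount G r v)) ≤ M := by
  classical
  have hmain : ∑ p : SimpleGraph (Fin n) × (Fin n → Fin L),
      (μ p.1).toReal * Real.exp (θ * descendingEdgeCount p.1 p.2 v) ≤
      ∑ p : SimpleGraph (Fin n) × (Fin n → Fin L), M * (μ p.1).toReal := by
    refine Finset.sum_le_sum_of_fibers _ (fun p => p.2 v) _ _ fun p _ => ?_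
    -- Before any exposure the reference graph imposes no constraint, so `⊥` is an arbitrary choice;
    -- only the rank of `v` is fixed.
    have hst : ExplorationState (⊥ : SimpleGraph (Fin n)) p.2 [] {v} :=
      ⟨.nil, by simp, Or.inl ⟨rfl, by simp⟩, by simp, by simp⟩
    have key := sum_exp_incidentEdges_le hd hθ hμ hm hsup _ _ _ _ _ hst le_rfl
    have hfil : indistinguishable (⊥ : SimpleGraph (Fin n)) p.2 [] {v} =
        Finset.univ.filter fun p' => p'.2 v = p.2 v := by
      ext p'
      rw [mem_indistinguishable, Finset.mem_filter]
      simp [discovered, AgreeAt]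
    rw [hfil] at key
    have h0 : incidentEdges (⊥ : SimpleGraph (Fin n)) {u | u ∈ ([] : List (Fin n))} = ∅ := by
      ext e
      simp [incidentEdges]
    rw [h0, Set.ncard_empty, Nat.cast_zero, mul_zero, Real.exp_zero, one_mul,
      Finset.prod_singleton] at key
    have hset : ({u | u ∈ ([] : List (Fin n))} ∪ (({v} : Finset (Fin n)) : Set (Fin n))) = {v} := by
      ext u
      simp
    rw [hset] at key
    refine key.trans ?_
    rw [Finset.mul_sum]
    refine Finset.sum_le_sum fun p' _ => ?_
    exact mul_le_mul_of_nonneg_right (hM _) ENNReal.toReal_nonneg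
  rw [Fintype.sum_prod_type, Fintype.sum_prod_type] at hmain
  simp only [Finset.sum_const, nsmul_eq_mul, ← Finset.mul_sum, sum_toReal_eq_one] at hmain
  have hR : (0 : ℝ) < Fintype.card (Fin n → Fin L) := by
    have : Nonempty (Fin L) := ⟨⟨0, hL⟩⟩
    exact_mod_cast Fintype.card_pos
  simp only [uniformExpect, ← mul_div_assoc, ← Finset.sum_div]
  rw [div_le_iff₀ hR]
  refine hmain.trans (le_of_eq ?_)
  rw [Finset.card_univ, mul_one, mul_comm]

/-! ### Admissible weights -/

/-- A constant weight is admissible in the case of few edges and a single rank. -/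
theorem admissible_of_le_half {d : ℝ} (hd : 0 < d) (hd' : d ≤ 1 / 2) (a : Fin 1) :
    Real.exp (d * (Real.exp (1 / 10) * truncatedAverage (fun _ : Fin 1 => (5 / 4 : ℝ)) a - 1)) ≤
      5 / 4 := by
  have h1 : truncatedAverage (fun _ : Fin 1 => (5 / 4 : ℝ)) a = 5 / 4 := by
    simp [truncatedAverage, Subsingleton.elim (0 : Fin 1) a]
  have hexp : ∀ x : ℝ, 0 ≤ x → x ≤ 1 → Real.exp x ≤ 1 + x + x ^ 2 := by
    intro x hx hx1
    have := Real.abs_exp_sub_one_sub_id_le (x := x) (by rwa [abs_of_nonneg hx])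
    have := (abs_le.1 this).2
    linarith
  have h2 := hexp (1 / 10) (by norm_num) (by norm_num)
  have h3 : d * (Real.exp (1 / 10) * (5 / 4) - 1) ≤ 1 / 5 := by
    have : Real.exp (1 / 10) * (5 / 4) - 1 ≤ 2 / 5 := by linarith
    nlinarith
  rw [h1]
  refine (Real.exp_le_exp.2 h3).trans ((hexp (1 / 5) (by norm_num) (by norm_num)).trans ?_)
  norm_num

/-- Weights that double with every rank are admissible. -/
theorem admissible_geometric {L : ℕ} {d : ℝ} (hd : 1 / 2 ≤ d) (hL : 24 * d < L) (a : Fin L) :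
    Real.exp (d * (Real.exp (1 / (3 * d * 2 ^ L)) *
      truncatedAverage (fun j : Fin L => (1 : ℝ) + 2 * 2 ^ (j : ℕ) / 2 ^ L) a - 1)) ≤
      1 + 2 * 2 ^ (a : ℕ) / 2 ^ L := by
  have hL0 : (0 : ℝ) < L := by linarith
  have hd0 : 0 < d := by linarith
  have hexp : ∀ x : ℝ, 0 ≤ x → x ≤ 1 → Real.exp x ≤ 1 + 2 * x := by
    intro x hx hx1
    have := Real.abs_exp_sub_one_sub_id_le (x := x) (by rwa [abs_of_nonneg hx])
    have := (abs_le.1 this).2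
    nlinarith
  -- Here `x` is the excess of the weight over `1`. The exponent will be shown to be at most `x /
  -- 2`, and `exp (x / 2) ≤ 1 + x`.
  set x : ℝ := 2 * 2 ^ (a : ℕ) / 2 ^ L with hx
  have hx0 : 0 < x := by positivity
  have hx1 : x ≤ 1 := by
    rw [hx, div_le_one (by positivity), ← pow_succ']
    exact pow_le_pow_right₀ one_le_two a.2
  set y : ℝ := 1 / 2 ^ L with hy
  have hy0 : 0 < y := by positivity
  have hyx : 2 * y ≤ x := by
    rw [hx, hy, mul_one_div]
    gcongr
    nlinarith [one_le_pow₀ (one_le_two : (1 : ℝ) ≤ 2) (n := (a : ℕ))]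
  have hθ : (1 : ℝ) / (3 * d * 2 ^ L) = y / (3 * d) := by
    rw [hy]
    field_simp
  have hav : truncatedAverage (fun j : Fin L => (1 : ℝ) + 2 * 2 ^ (j : ℕ) / 2 ^ L) a ≤
      1 + 2 * x / L := by
    rw [truncatedAverage, div_le_iff₀ hL0]
    have h1 : ∀ j : Fin L, (if j ≤ a then (1 : ℝ) + 2 * 2 ^ (j : ℕ) / 2 ^ L else 1) =
        1 + 2 / 2 ^ L * if (j : ℕ) ≤ a then 2 ^ (j : ℕ) else 0 := by
      intro j
      simp only [Fin.le_def]
      split_ifs <;> ring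
    simp_rw [h1]
    rw [Finset.sum_add_distrib, ← Finset.mul_sum]
    -- Doubling weights make the sum over ranks up to `a` comparable to its last term, so averaging
    -- over `L` ranks gains a factor of order `1 / L`.
    have h2 : ∑ j : Fin L, (if (j : ℕ) ≤ a then (2 : ℝ) ^ (j : ℕ) else 0) ≤ 2 * 2 ^ (a : ℕ) := by
      rw [Fin.sum_univ_eq_sum_range (fun j => if j ≤ (a : ℕ) then (2 : ℝ) ^ j else 0),
        ← Finset.sum_filter]
      calc _ ≤ ∑ j ∈ Finset.range (a + 1), (2 : ℝ) ^ j := by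
            refine Finset.sum_le_sum_of_subset_of_nonneg ?_ fun _ _ _ => by positivity
            intro j hj
            rw [Finset.mem_filter] at hj
            exact Finset.mem_range.2 (by omega)
        _ ≤ _ := by
            rw [geom_sum_eq (by norm_num), pow_succ]
            linarith
    have h3 : (2 : ℝ) / 2 ^ L * ∑ j : Fin L, (if (j : ℕ) ≤ a then (2 : ℝ) ^ (j : ℕ) else 0) ≤
        2 * x := by
      calc _ ≤ (2 : ℝ) / 2 ^ L * (2 * 2 ^ (a : ℕ)) := by gcongr
        _ = _ := by rw [hx]; ring
    have h4 : (1 + 2 * x / L) * (L : ℝ) = L + 2 * x := by field_simp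
    simp only [Finset.sum_const, Finset.card_univ, Fintype.card_fin, nsmul_eq_mul, mul_one]
    linarith
  have hy1 : y ≤ 1 / 2 := by linarith
  have hdθ : d * (y / (3 * d)) = y / 3 := by field_simp
  have hθ1 : y / (3 * d) ≤ 1 / 2 := by
    rw [div_le_iff₀ (by positivity)]
    nlinarith
  have hθ0 : 0 ≤ y / (3 * d) := by positivity
  -- This is where `24 * d < L` enters. New waiting vertices then cost at most `x / 6` and edges at
  -- most `2 * y / 3 ≤ x / 3`, together `x / 2`.
  have hdx : d * (2 * x / L) ≤ x / 12 := by
    rw [mul_div_assoc', div_le_iff₀ hL0]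
    nlinarith
  have hexp1 := hexp (y / (3 * d)) hθ0 (by linarith)
  have hle : d * (Real.exp (y / (3 * d)) *
      truncatedAverage (fun j : Fin L => (1 : ℝ) + 2 * 2 ^ (j : ℕ) / 2 ^ L) a - 1) ≤ x / 2 := by
    have h2xL : 0 ≤ 2 * x / L := by positivity
    calc _ ≤ d * ((1 + 2 * (y / (3 * d))) * (1 + 2 * x / L) - 1) := by
          have h0 := one_le_truncatedAverage
            (m := fun j : Fin L => (1 : ℝ) + 2 * 2 ^ (j : ℕ) / 2 ^ L)
            (fun j => le_add_of_nonneg_right (by positivity)) a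
          exact mul_le_mul_of_nonneg_left (sub_le_sub_right (mul_le_mul hexp1 hav
            (zero_le_one.trans h0) (by linarith)) 1) hd0.le
      _ = 2 * (d * (y / (3 * d))) + (1 + 2 * (y / (3 * d))) * (d * (2 * x / L)) := by ring
      _ ≤ 2 * (y / 3) + 2 * (x / 12) := by
          rw [hdθ]
          gcongr
          linarith
      _ ≤ x / 2 := by linarith
  rw [hθ]
  refine (Real.exp_le_exp.2 hle).trans ((hexp (x / 2) (by linarith) (by linarith)).trans ?_)
  linarith

/-! ### Distinguishers that explore a vicinity -/

/-- If the part `K F` of the domain of `F` can be found adaptively, and determines whether `F`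
satisfies `B`, then `B` is decided with `k` queries unless `K F` has more than `k` points. -/
theorem exists_distinguisher {X Y : Type} [Finite X] (K : (X → Y) → Set X) (B : (X → Y) → Prop)
    (hK : ∀ (T : Set X) (ρ : X → Y), K ρ ⊆ T ∨
      ∃ x ∉ T, ∀ F : X → Y, (∀ y ∈ T, F y = ρ y) → x ∈ K F)
    (hB : ∀ F F' : X → Y, (∀ x ∈ K F, F' x = F x) → (B F' ↔ B F)) (k : ℕ) :
    ∀ (T : Set X) (ρ : X → Y), (∀ F : X → Y, (∀ y ∈ T, F y = ρ y) → T ⊆ K F) →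
      ∃ D : Distinguisher X Y, (∀ F, D.numQueries F ≤ k) ∧
        ∀ F : X → Y, (∀ y ∈ T, F y = ρ y) →
          (B F → D.eval F = true) ∧ (D.eval F = true → B F ∨ T.ncard + k < (K F).ncard) := by
  classical
  induction k with
  | zero =>
    intro T ρ hT
    rcases hK T ρ with h | ⟨x, hxT, hx⟩
    · refine ⟨.output (decide (B ρ)), fun F => le_rfl, fun F hF => ?_⟩
      have := hB ρ F fun x hx => hF x (h hx)
      simpa [Distinguisher.eval, this] using Or.inl
    -- Out of queries, the answer `true` makes the error one-sided: `B` is never missed, and a false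
    -- alarm certifies that `K F` is large.
    · refine ⟨.output true, fun F => le_rfl, fun F hF => ⟨fun _ => rfl, fun _ => Or.inr ?_⟩⟩
      refine Set.ncard_lt_ncard (Set.ssubset_iff_exists.2 ⟨hT F hF, x, hx F hF, hxT⟩)
        (Set.toFinite _)
  | succ k ih =>
    intro T ρ hT
    rcases hK T ρ with h | ⟨x, hxT, hx⟩
    · refine ⟨.output (decide (B ρ)), fun F => Nat.zero_le _, fun F hF => ?_⟩
      have := hB ρ F fun x hx => hF x (h hx)
      simpa [Distinguisher.eval, this] using Or.inl
    · have hagree : ∀ (y : Y) (F : X → Y),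
          (∀ z ∈ insert x T, F z = Function.update ρ x y z) → ∀ z ∈ T, F z = ρ z := by
        intro y F hF z hz
        rw [hF z (Set.mem_insert_of_mem _ hz), Function.update_of_ne]
        rintro rfl
        exact hxT hz
      have hsub : ∀ (y : Y) (F : X → Y),
          (∀ z ∈ insert x T, F z = Function.update ρ x y z) → insert x T ⊆ K F := by
        intro y F hF
        exact Set.insert_subset (hx F (hagree y F hF)) (hT F (hagree y F hF))
      choose D hD1 hD2 using fun y => ih (insert x T) (Function.update ρ x y) (hsub y)
      refine ⟨.query x D, fun F => Nat.succ_le_succ (hD1 _ F), fun F hF => ?_⟩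
      have h2 := hD2 (F x) F fun z hz => by
        by_cases hzx : z = x
        · rw [hzx, Function.update_self]
        · rw [Function.update_of_ne hzx]
          exact hF z (hz.resolve_left hzx)
      rw [Set.ncard_insert_of_notMem hxT] at h2
      refine ⟨h2.1, fun h => (h2.2 h).imp id fun h' => ?_⟩
      omega

/-- The vicinity of `v` together with its neighbours. -/
def closedVicinity {V : Type*} {L : ℕ} (G : SimpleGraph V) (v : V) (r : V → Fin L) : Set V :=
  descendingClosure G r {v} ∪ outerNeighbors G (descendingClosure G r {v})

theorem mem_closedVicinity_of_adj {V : Type*} {L : ℕ} {G : SimpleGraph V} {v : V}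
    {r : V → Fin L} {u x : V} (hu : u ∈ descendingClosure G r {v}) (hx : G.Adj u x) :
    x ∈ closedVicinity G v r := by
  by_cases h : x ∈ descendingClosure G r {v}
  · exact Or.inl h
  · exact Or.inr ⟨h, u, hu, hx⟩

theorem descendingClosure_congr {V : Type*} {L : ℕ} {G : SimpleGraph V} {v : V}
    {r r' : V → Fin L} (h : ∀ x ∈ closedVicinity G v r, r' x = r x) :
    descendingClosure G r' {v} = descendingClosure G r {v} := by
  have hv : ∀ s : V → Fin L, v ∈ descendingClosure G s {v} := fun s =>
    subset_descendingClosure G s _ rfl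
  refine subset_antisymm (descendingClosure_subset (by simpa using hv r) ?_) ?_
  · intro u hu x hx hle
    rw [h u (Or.inl hu), h x (mem_closedVicinity_of_adj hu hx)] at hle
    exact descendingClosure_closed G r _ u hu x hx hle
  · refine (descendingClosure_subset
      (T := descendingClosure G r {v} ∩ descendingClosure G r' {v}) ?_ ?_).trans
      Set.inter_subset_right
    · rw [Set.singleton_subset_iff]
      exact ⟨hv r, hv r'⟩
    · rintro u ⟨hu, hu'⟩ x hx hle
      refine ⟨descendingClosure_closed G r _ u hu x hx hle,
        descendingClosure_closed G r' _ u hu' x hx ?_⟩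
      rwa [h u (Or.inl hu), h x (mem_closedVicinity_of_adj hu hx)]

/-- Search from `v` using known ranks only. Either an unqueried neighbour of a vertex already
reached turns up, which belongs to the closed vicinity however the ranks continue, or the search is
complete. -/
theorem closedVicinity_explorable {V : Type*} {L : ℕ} (G : SimpleGraph V) (v : V) (T : Set V)
    (ρ : V → Fin L) : closedVicinity G v ρ ⊆ T ∨
      ∃ x ∉ T, ∀ F : V → Fin L, (∀ y ∈ T, F y = ρ y) → x ∈ closedVicinity G v F := by
  by_cases hv : v ∈ T
  swap
  · exact Or.inr ⟨v, hv, fun F _ => Or.inl (subset_descendingClosure G F _ rfl)⟩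
  set R : Set V := {w | Relation.ReflTransGen (fun u w => G.Adj u w ∧ ρ w ≤ ρ u ∧ w ∈ T) v w}
    with hR
  have hRT : R ⊆ T := by
    intro w hw
    rcases Relation.ReflTransGen.cases_tail hw with rfl | ⟨u, -, h⟩
    · exact hv
    · exact h.2.2
  have hRF : ∀ F : V → Fin L, (∀ y ∈ T, F y = ρ y) → R ⊆ descendingClosure G F {v} := by
    intro F hF w hw
    induction hw with
    | refl => exact subset_descendingClosure G F _ rfl
    | tail hu h ih =>
      refine descendingClosure_closed G F _ _ ih _ h.1 ?_
      rw [hF _ h.2.2, hF _ (hRT hu)]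
      exact h.2.1
  by_cases hN : ∀ u ∈ R, ∀ x, G.Adj u x → x ∈ T
  · left
    have hcl : descendingClosure G ρ {v} ⊆ R := by
      refine descendingClosure_subset (Set.singleton_subset_iff.2 .refl) ?_
      intro u hu x hx hle
      exact Relation.ReflTransGen.tail hu ⟨hx, hle, hN u hu x hx⟩
    rintro x (hx | ⟨-, u, hu, hux⟩)
    · exact hRT (hcl hx)
    · exact hN u (hcl hu) x hux
  · push Not at hN
    obtain ⟨u, hu, x, hux, hxT⟩ := hN
    exact Or.inr ⟨x, hxT, fun F hF => mem_closedVicinity_of_adj (hRF F hF hu) hux⟩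

/-- Every vertex of the closed vicinity other than `v` is an endpoint of a counted edge. -/
theorem ncard_closedVicinity_le {n L : ℕ} (G : SimpleGraph (Fin n)) (v : Fin n)
    (r : Fin n → Fin L) :
    (closedVicinity G v r).ncard ≤ 2 * descendingEdgeCount G r v + 1 := by
  classical
  set E := (Set.toFinite (incidentEdges G (descendingClosure G r {v}))).toFinset with hE
  have hcard : E.card = descendingEdgeCount G r v := by
    rw [descendingEdgeCount, Set.ncard_eq_toFinset_card _ (Set.toFinite _)]
  have hsub : closedVicinity G v r ⊆ (insert v (E.biUnion Sym2.toFinset) : Finset (Fin n)) := by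
    intro x hx
    rw [Finset.coe_insert]
    by_cases hxv : x = v
    · exact Or.inl hxv
    right
    obtain ⟨u, hu, hux⟩ : ∃ u ∈ descendingClosure G r {v}, G.Adj u x := by
      rcases hx with ⟨y, hy, h⟩ | ⟨-, u, hu, hux⟩
      · obtain rfl : y = v := hy
        rcases Relation.ReflTransGen.cases_tail h with h | ⟨u, hu, hux⟩
        · exact absurd h hxv
        · exact ⟨u, ⟨y, rfl, hu⟩, hux.1⟩
      · exact ⟨u, hu, hux⟩
    rw [Finset.mem_coe, Finset.mem_biUnion]
    refine ⟨s(u, x), ?_, by simp⟩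
    rw [hE, Set.Finite.mem_toFinset]
    exact ⟨hux, u, hu, Sym2.mem_mk_left _ _⟩
  calc (closedVicinity G v r).ncard ≤ (insert v (E.biUnion Sym2.toFinset)).card := by
        rw [← Set.ncard_coe_finset]
        exact Set.ncard_le_ncard hsub (Set.toFinite _)
    _ ≤ (E.biUnion Sym2.toFinset).card + 1 := Finset.card_insert_le _ _
    _ ≤ E.card * 2 + 1 := by
        gcongr
        refine Finset.card_biUnion_le_card_mul _ _ _ fun e _ => ?_
        rw [Sym2.card_toFinset]
        split_ifs <;> norm_num
    _ = _ := by rw [hcard, mul_comm]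

/-! ### Expectations under almost adaptively independent ranks -/

theorem uniformProb_mono {α : Type*} [Fintype α] {A B : Set α} (h : A ⊆ B) :
    uniformProb A ≤ uniformProb B := by
  unfold uniformProb
  gcongr
  exact Set.toFinite _

theorem uniformProb_union_le {α : Type*} [Fintype α] (A B : Set α) :
    uniformProb (A ∪ B) ≤ uniformProb A + uniformProb B := by
  unfold uniformProb
  rw [← add_div]
  gcongr
  exact_mod_cast Set.ncard_union_le A B

theorem uniformExpect_mono {α : Type*} [Fintype α] {f g : α → ℝ} (h : ∀ a, f a ≤ g a) :
    uniformExpect f ≤ uniformExpect g := by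
  unfold uniformExpect
  gcongr with a
  exact h a

theorem uniformExpect_const_mul {α : Type*} [Fintype α] (c : ℝ) (f : α → ℝ) :
    uniformExpect (fun a => c * f a) = c * uniformExpect f := by
  unfold uniformExpect
  rw [← Finset.mul_sum, mul_div_assoc]

open Classical in
theorem uniformProb_eq_uniformExpect {α : Type*} [Fintype α] (A : Set α) :
    uniformProb A = uniformExpect fun a => if a ∈ A then (1 : ℝ) else 0 := by
  unfold uniformProb uniformExpect
  rw [Finset.sum_boole, Set.ncard_eq_toFinset_card' A]
  congr 3
  ext a
  simp

/-- Markov's inequality for the exponential of a random variable. -/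
theorem uniformProb_le_exp_mul {α : Type*} [Fintype α] {θ : ℝ} (hθ : 0 ≤ θ) (f : α → ℝ) (b : ℝ) :
    uniformProb {a | b ≤ f a} ≤
      Real.exp (-(θ * b)) * uniformExpect fun a => Real.exp (θ * f a) := by
  classical
  rw [uniformProb_eq_uniformExpect, ← uniformExpect_const_mul]
  refine uniformExpect_mono fun a => ?_
  split_ifs with h
  · rw [← Real.exp_add]
    refine Real.one_le_exp ?_
    have := mul_le_mul_of_nonneg_left (show b ≤ f a from h) hθ
    linarith
  · positivity

theorem sq_min_eq_sum (x N : ℕ) :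
    ((min x N : ℕ) : ℝ) ^ 2 =
      ∑ t ∈ Finset.range N, (2 * t + 1) * (if t < x then (1 : ℝ) else 0) := by
  induction N with
  | zero => simp
  | succ N ih =>
    rw [Finset.sum_range_succ, ← ih]
    split_ifs with h
    · rw [min_eq_right h, min_eq_right h.le]
      push_cast
      ring
    · rw [min_eq_left (by omega), min_eq_left (by omega)]
      ring

theorem uniformExpect_sq_eq_sum {α : Type*} [Fintype α] (f : α → ℕ) {N : ℕ} (hf : ∀ a, f a ≤ N) :
    uniformExpect (fun a => (f a : ℝ) ^ 2) =
      ∑ t ∈ Finset.range N, (2 * (t : ℝ) + 1) * uniformProb {a | t < f a} := by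
  classical
  simp_rw [uniformProb_eq_uniformExpect, ← uniformExpect_const_mul]
  unfold uniformExpect
  rw [← Finset.sum_div, Finset.sum_comm]
  congr 1
  refine Finset.sum_congr rfl fun a _ => ?_
  have := sq_min_eq_sum (f a) N
  rw [min_eq_left (hf a)] at this
  refine this.trans (Finset.sum_congr rfl fun t _ => ?_)
  congr 1
  by_cases h : t < f a <;> simp [h]

/-- The distinguisher accepts whenever the event holds. Under random ranks it accepts wrongly only
if the closed vicinity has more than `k` points, hence if twice the edge count is at least `k`. -/
theorem AlmostAdaptiveIndep.uniformProb_le {n L k : ℕ} {ε : ℝ} {ι : Type*} [Fintype ι]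
    {H : ι → Fin n → Fin L} (hH : AlmostAdaptiveIndep ε k H) (G : SimpleGraph (Fin n))
    (v : Fin n) (t : ℕ) (hne : Nonempty (Fin n → Fin L)) :
    uniformProb {i | t < descendingEdgeCount G (H i) v} ≤
      uniformProb {F : Fin n → Fin L | t < descendingEdgeCount G F v} +
        uniformProb {F : Fin n → Fin L | k ≤ 2 * descendingEdgeCount G F v} + ε := by
  obtain ⟨ρ⟩ := hne
  obtain ⟨D, hD, hD'⟩ := exists_distinguisher (closedVicinity G v (L := L))
    (fun F => t < descendingEdgeCount G F v) (closedVicinity_explorable G v)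
    (fun F F' h => by rw [descendingEdgeCount, descendingEdgeCount, descendingClosure_congr h])
    k ∅ ρ (fun _ _ => Set.empty_subset _)
  have hD1 : ∀ F, t < descendingEdgeCount G F v → D.eval F = true := fun F =>
    (hD' F (by simp)).1
  have hD2 : {F : Fin n → Fin L | D.eval F = true} ⊆
      {F | t < descendingEdgeCount G F v} ∪ {F | k ≤ 2 * descendingEdgeCount G F v} := by
    intro F hF
    refine ((hD' F (by simp)).2 hF).imp id fun h => ?_
    have := ncard_closedVicinity_le G v F
    rw [Set.ncard_empty] at h
    show k ≤ 2 * descendingEdgeCount G F v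
    omega
  have h1 : uniformProb {i | t < descendingEdgeCount G (H i) v} ≤
      uniformProb {i | D.eval (H i) = true} := uniformProb_mono fun i hi => hD1 _ hi
  have h2 := (uniformProb_mono hD2).trans (uniformProb_union_le _ _)
  have h3 := (abs_le.1 (hH D hD)).2
  linarith

/-- The second moment is the sum of tails with weights `2 * t + 1` over `t < n ^ 2`. The total
weight `n ^ 4` multiplies the error of each tail. -/
theorem AlmostAdaptiveIndep.uniformExpect_sq_le {n L k : ℕ} {ε : ℝ} {ι : Type*} [Fintype ι]
    {H : ι → Fin n → Fin L} (hH : AlmostAdaptiveIndep ε k H) (G : SimpleGraph (Fin n))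
    (v : Fin n) (hne : Nonempty (Fin n → Fin L)) :
    uniformExpect (fun i => (descendingEdgeCount G (H i) v : ℝ) ^ 2) ≤
      uniformExpect (fun F : Fin n → Fin L => (descendingEdgeCount G F v : ℝ) ^ 2) +
        (n : ℝ) ^ 4 *
          (uniformProb {F : Fin n → Fin L | k ≤ 2 * descendingEdgeCount G F v} + ε) := by
  have hsum : ∑ t ∈ Finset.range (n ^ 2), (2 * (t : ℝ) + 1) = (n : ℝ) ^ 4 := by
    have := sq_min_eq_sum (n ^ 2) (n ^ 2)
    rw [min_self] at this
    rw [show (n : ℝ) ^ 4 = ((n ^ 2 : ℕ) : ℝ) ^ 2 by push_cast; ring, this]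
    refine Finset.sum_congr rfl fun t ht => ?_
    rw [if_pos (Finset.mem_range.1 ht), mul_one]
  rw [uniformExpect_sq_eq_sum _ fun i => descendingEdgeCount_le_sq G (H i) v,
    uniformExpect_sq_eq_sum _ fun F : Fin n → Fin L => descendingEdgeCount_le_sq G F v, ← hsum,
    Finset.sum_mul, ← Finset.sum_add_distrib]
  refine Finset.sum_le_sum fun t _ => ?_
  rw [← mul_add]
  have := hH.uniformProb_le G v t hne
  gcongr
  linarith

/-! ### The second moment of the edge count -/

theorem sq_le_exp_mul {θ x : ℝ} (hθ : 0 < θ) (hx : 0 ≤ x) :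
    x ^ 2 ≤ 2 / θ ^ 2 * Real.exp (θ * x) := by
  have := Real.quadratic_le_exp_of_nonneg (mul_nonneg hθ.le hx)
  rw [div_mul_eq_mul_div, le_div_iff₀ (by positivity)]
  nlinarith [mul_nonneg hθ.le hx]

theorem uniformExpect_le_of_le {α : Type*} [Fintype α] {f : α → ℝ} {b : ℝ} (hb : 0 ≤ b)
    (h : ∀ a, f a ≤ b) : uniformExpect f ≤ b := by
  refine (uniformExpect_mono h).trans ?_
  unfold uniformExpect
  rw [Finset.sum_const, nsmul_eq_mul, Finset.card_univ]
  exact div_le_of_le_mul₀ (Nat.cast_nonneg _) hb (le_of_eq (mul_comm _ _))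

/-- For a sparse distribution even the edges of the whole component have bounded second moment. -/
theorem secondMoment_le_of_le_half {n L : ℕ} {d : ℝ} (hd : 0 < d) (hd' : d ≤ 1 / 2)
    {μ : PMF (SimpleGraph (Fin n))} (hμ : IsLight d μ) {ι : Type*} [Fintype ι]
    (H : ι → Fin n → Fin L) (v : Fin n) :
    ∑ G : SimpleGraph (Fin n), (μ G).toReal *
      uniformExpect (fun i : ι => (vicinityEdgeCount G (H i) v : ℝ) ^ 2) ≤ 250 := by
  have key := sum_exp_descendingEdgeCount_le (L := 1) one_pos hd (by norm_num) hμ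
    (m := fun _ => 5 / 4) (fun _ => by norm_num) (fun _ => le_rfl)
    (admissible_of_le_half hd hd') v
  calc _ ≤ ∑ G : SimpleGraph (Fin n), 200 * ((μ G).toReal * uniformExpect
        (fun r : Fin n → Fin 1 => Real.exp (1 / 10 * descendingEdgeCount G r v))) := by
        refine Finset.sum_le_sum fun G _ => ?_
        rw [mul_left_comm]
        refine mul_le_mul_of_nonneg_left ?_ ENNReal.toReal_nonneg
        have hconst : uniformExpect
            (fun r : Fin n → Fin 1 => Real.exp (1 / 10 * descendingEdgeCount G r v)) =
            Real.exp (1 / 10 * descendingEdgeCount G (fun _ => (0 : Fin 1)) v) := by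
          unfold uniformExpect
          rw [Fintype.sum_unique, Fintype.card_unique, Nat.cast_one, div_one]
          congr
        rw [hconst]
        refine uniformExpect_le_of_le (by positivity) fun i => ?_
        have h1 : (vicinityEdgeCount G (H i) v : ℝ) ≤
            descendingEdgeCount G (fun _ => (0 : Fin 1)) v := by
          exact_mod_cast (vicinityEdgeCount_le G (H i) v).trans
            (descendingEdgeCount_le_const G (H i) _ v)
        refine (pow_le_pow_left₀ (Nat.cast_nonneg _) h1 2).trans ?_
        refine (sq_le_exp_mul (θ := 1 / 10) (by norm_num) (Nat.cast_nonneg _)).trans (le_of_eq ?_)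
        norm_num
    _ ≤ 200 * (5 / 4) := by
        rw [← Finset.mul_sum]
        exact mul_le_mul_of_nonneg_left key (by norm_num)
    _ = 250 := by norm_num

theorem secondMoment_le_of_half_le {n L k : ℕ} {d : ℝ} (hd : 1 / 2 ≤ d) (hL : 24 * d < L)
    (hk : 6 * d * (2 ^ L * 4 * Real.log n) ≤ k)
    {μ : PMF (SimpleGraph (Fin n))} (hμ : IsLight d μ) {ι : Type*} [Fintype ι]
    {H : ι → Fin n → Fin L} (hH : AlmostAdaptiveIndep (1 / (2 * (n : ℝ) ^ 5)) k H) (v : Fin n) :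
    ∑ G : SimpleGraph (Fin n), (μ G).toReal *
      uniformExpect (fun i : ι => (vicinityEdgeCount G (H i) v : ℝ) ^ 2) ≤
        4 * (3 * d * 2 ^ L) ^ 2 + 3 := by
  have hd0 : 0 < d := by linarith
  have hL0 : 0 < L := by
    have : (0 : ℝ) < L := by linarith
    exact_mod_cast this
  have hn : (0 : ℝ) < n := by exact_mod_cast v.pos
  have hn1 : (1 : ℝ) ≤ n := by exact_mod_cast v.pos
  have hne : Nonempty (Fin n → Fin L) := ⟨fun _ => ⟨0, hL0⟩⟩
  set θ : ℝ := 1 / (3 * d * 2 ^ L) with hθ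
  have hθ0 : 0 < θ := by positivity
  have hm2 : ∀ j : Fin L, (1 : ℝ) + 2 * 2 ^ (j : ℕ) / 2 ^ L ≤ 2 := by
    intro j
    have : (2 : ℝ) * 2 ^ (j : ℕ) / 2 ^ L ≤ 1 := by
      rw [div_le_one (by positivity), ← pow_succ']
      exact pow_le_pow_right₀ one_le_two j.2
    linarith
  have key := sum_exp_descendingEdgeCount_le hL0 hd0 hθ0.le hμ
    (m := fun j : Fin L => (1 : ℝ) + 2 * 2 ^ (j : ℕ) / 2 ^ L)
    (fun j => le_add_of_nonneg_right (by positivity)) hm2 (admissible_geometric hd hL) v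
  set Φ : SimpleGraph (Fin n) → ℝ := fun G =>
    uniformExpect (fun r : Fin n → Fin L => Real.exp (θ * descendingEdgeCount G r v)) with hΦ
  have hΦ0 : ∀ G, 0 ≤ Φ G := fun G =>
    div_nonneg (Finset.sum_nonneg fun _ _ => Real.exp_nonneg _) (Nat.cast_nonneg _)
  have htail : Real.exp (-(θ * (k / 2))) ≤ 1 / (n : ℝ) ^ 4 := by
    -- The lower bound on `k` is matched to `θ = 1 / (3 * d * 2 ^ L)` and `c = 4`, so that the
    -- Markov factor cancels the weight `n ^ 4`.
    have h1 : 4 * Real.log n ≤ θ * (k / 2) := by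
      rw [hθ, div_mul_eq_mul_div, le_div_iff₀ (by positivity)]
      linarith
    calc Real.exp (-(θ * (k / 2))) ≤ Real.exp (-(4 * Real.log n)) :=
          Real.exp_le_exp.2 (neg_le_neg h1)
      _ = 1 / (n : ℝ) ^ 4 := by
          rw [Real.exp_neg, one_div]
          congr 1
          rw [show 4 * Real.log n = ((4 : ℕ) : ℝ) * Real.log n by norm_num, Real.exp_nat_mul,
            Real.exp_log hn]
  have hG : ∀ G : SimpleGraph (Fin n),
      uniformExpect (fun i : ι => (vicinityEdgeCount G (H i) v : ℝ) ^ 2) ≤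
        (2 / θ ^ 2 + 1) * Φ G + 1 := by
    intro G
    have h1 : uniformExpect (fun i : ι => (vicinityEdgeCount G (H i) v : ℝ) ^ 2) ≤
        uniformExpect (fun i : ι => (descendingEdgeCount G (H i) v : ℝ) ^ 2) :=
      uniformExpect_mono fun i => pow_le_pow_left₀ (Nat.cast_nonneg _)
        (Nat.cast_le.2 (vicinityEdgeCount_le G (H i) v)) 2
    have h2 := hH.uniformExpect_sq_le G v hne
    have h3 : uniformExpect (fun F : Fin n → Fin L => (descendingEdgeCount G F v : ℝ) ^ 2) ≤
        2 / θ ^ 2 * Φ G := by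
      rw [hΦ, ← uniformExpect_const_mul]
      exact uniformExpect_mono fun F => sq_le_exp_mul hθ0 (Nat.cast_nonneg _)
    have h4 : uniformProb {F : Fin n → Fin L | k ≤ 2 * descendingEdgeCount G F v} ≤
        1 / (n : ℝ) ^ 4 * Φ G := by
      refine le_trans (uniformProb_mono ?_) ((uniformProb_le_exp_mul hθ0.le
        (fun F : Fin n → Fin L => (descendingEdgeCount G F v : ℝ)) (k / 2)).trans
        (mul_le_mul_of_nonneg_right htail (hΦ0 G)))
      intro F hF
      have : (k : ℝ) ≤ 2 * descendingEdgeCount G F v := by exact_mod_cast hF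
      show (k : ℝ) / 2 ≤ descendingEdgeCount G F v
      linarith
    have h5 : (n : ℝ) ^ 4 * (1 / (n : ℝ) ^ 4 * Φ G + 1 / (2 * (n : ℝ) ^ 5)) ≤ Φ G + 1 := by
      have : (n : ℝ) ^ 4 * (1 / (n : ℝ) ^ 4 * Φ G + 1 / (2 * (n : ℝ) ^ 5)) =
          Φ G + 1 / (2 * n) := by field_simp
      rw [this]
      gcongr
      rw [div_le_one (by positivity)]
      linarith
    have h6 := mul_le_mul_of_nonneg_left
      (add_le_add_left h4 (1 / (2 * (n : ℝ) ^ 5))) (by positivity : (0 : ℝ) ≤ (n : ℝ) ^ 4)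
    linarith
  calc _ ≤ ∑ G : SimpleGraph (Fin n),
        ((2 / θ ^ 2 + 1) * ((μ G).toReal * Φ G) + (μ G).toReal) := by
        refine Finset.sum_le_sum fun G _ => ?_
        refine (mul_le_mul_of_nonneg_left (hG G) ENNReal.toReal_nonneg).trans (le_of_eq ?_)
        ring
    _ = (2 / θ ^ 2 + 1) * ∑ G : SimpleGraph (Fin n), (μ G).toReal * Φ G + 1 := by
        rw [Finset.sum_add_distrib, ← Finset.mul_sum, sum_toReal_eq_one]
    _ ≤ (2 / θ ^ 2 + 1) * 2 + 1 := by
        gcongr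
    _ = 4 * (3 * d * 2 ^ L) ^ 2 + 3 := by
        rw [hθ]
        field_simp
        ring

theorem mainTheorem3 :
    ∃ c : ℝ, 0 < c ∧
      ∀ d A : ℝ, 0 < d → ∃ C : ℝ,
        ∀ (L n k : ℕ), 24 * d < L → (L : ℝ) ≤ A * d →
          6 * d * (2 ^ L * c * Real.log n) ≤ k →
          ∀ (μ : PMF (SimpleGraph (Fin n))), IsLight d μ →
          ∀ {ι : Type*} [Fintype ι] [Nonempty ι] (H : ι → Fin n → Fin L),
            AlmostAdaptiveIndep (1 / (2 * (n : ℝ) ^ 5)) k H →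
            ∀ v : Fin n,
              ∑ G : SimpleGraph (Fin n), (μ G).toReal *
                uniformExpect (fun i : ι => (vicinityEdgeCount G (H i) v : ℝ) ^ 2) ≤ C := by
  -- The constant must not depend on `L`, so `2 ^ L` is replaced by its largest admissible value;
  -- adding the bounds for the two ranges of `d` covers both.
  refine ⟨4, by norm_num, fun d A hd =>
    ⟨250 + (4 * (3 * d * 2 ^ ⌊A * d⌋₊) ^ 2 + 3), ?_⟩⟩
  intro L n k hL hLA hk μ hμ ι _ _ H hH v
  rcases le_total d (1 / 2) with h | h
  · refine (secondMoment_le_of_le_half hd h hμ H v).trans ?_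
    have : 0 ≤ 4 * (3 * d * (2 : ℝ) ^ ⌊A * d⌋₊) ^ 2 := by positivity
    linarith
  · refine (secondMoment_le_of_half_le h hL hk hμ hH v).trans ?_
    have : 4 * (3 * d * (2 : ℝ) ^ L) ^ 2 ≤ 4 * (3 * d * (2 : ℝ) ^ ⌊A * d⌋₊) ^ 2 := by
      gcongr
      · exact one_le_two
      · exact Nat.le_floor hLA
    linarith
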